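/- Let $n\ge 3$, let $\Gamma$ be a connected simple graph on $[n]=\{1,\dots,n\}$, and write $\mathbb{C}[t_\bullet]=\mathbb{C}[t_1,\dots,t_n]$. The ring of splines is the subring $$\mathcal{S}_\Gamma=\Bigl\{\rho\in\prod_{w\in S_n}\mathbb{C}[t_\bullet]\;\Big|\;\rho(w)-\rho(w(i,j))\in\langle t_{w(i)}-t_{w(j)}\rangle\text{ for all }w\in S_n\text{ and all edges }(i,j)\text{ of }\Gamma\Bigr\}$$ with pointwise operations, graded by polynomial degree; $\mathcal{S}_\Gamma^1$ is the space of splines all of whose values are homogeneous of degree $1$ (or zero). Let $\bar t_i,\bar x_i\in\mathcal{S}_\Gamma$ be the splines $\bar t_i(w)=t_i$ and $\bar x_i(w)=t_{w(i)}$, and let $\mathrm{L}_\Gamma=\mathcal{S}_\Gamma/\langle\bar t_1,\dots,\bar t_n\rangle$ and $\mathrm{R}_\Gamma=\mathcal{S}_\Gamma/\langle\bar x_1,\dots,\bar x_n\rangle$ with the induced gradings. A vertex $j$ is a cut vertex if $\Gamma-j$ is disconnected, and then $\mathfrak{c}(j)+1$ denotes the number of connected components of $\Gamma-j$. A block is a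 maximal $2$-connected subgraph of $\Gamma$, where a graph is $2$-connected if it is connected and stays connected (in particular non-empty) after removal of any one vertex, so that a single edge is $2$-connected. The block-cut tree has the cut vertices and the blocks of $\Gamma$ as its vertices, with $v$ joined to $B$ when $v\in B$. Let $\mathrm{LB}_\Gamma$ be the set of blocks that are leaves (vertices of degree $1$) of the block-cut tree and $\mathrm{IB}_\Gamma$ the set of all other blocks (so if $\Gamma$ itself is $2$-connected, then $\mathrm{LB}_\Gamma=\emptyset$ and $\mathrm{IB}_\Gamma=\{\Gamma\}$). Let $\mathrm{IC}_\Gamma$ be the set of edges $(i,j)$ of $\Gamma$ such that $\{i,j\}$ is the vertex set of some $B\in\mathrm{IB}_\Gamma$. For $s\in\mathrm{IC}_\Gamma$ let $G_s$ be either of the two connected components of $([n],E(\Gamma)\setminus\{s\})$, and $|G_s|$ its number of vertices. Put $$D_\Gamma=2n-1-\sum_{j\text{ cut vertex}}\mathfrak{c}(j)+n\Bigl(|\mathrm{LB}_\Gamma|+\bigl|\{B\in\mathrm{IB}_\Gamma:|B|>2\}\bigr|-1\Bigr)+\sum_{s\in\mathrm{IC}_\Gamma}\binom{n}{|G_s|}.$$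 Then, for every choice of the components $G_s$, $\dim_{\mathbb{C}}\mathcal{S}_\Gamma^1=D_\Gamma$. Moreover, the degree-$1$ pieces of the two quotients satisfy $\dim_{\mathbb{C}}(\mathrm{L}_\Gamma)_1=\dim_{\mathbb{C}}(\mathrm{R}_\Gamma)_1=D_\Gamma-n$. -/

import Mathlib

namespace CayleySplines

/-! ### Graph theory -/

/-- `G` is `k`-connected: `G ∖ A` is connected for every vertex set `A` with `|A| ≤ k - 1`.
(`Connected` includes non-emptiness of the vertex set.) -/
def IsKConnected {V : Type*} (G : SimpleGraph V) (k : ℕ) : Prop :=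
  ∀ A : Set V, A.encard < k → (G.induce Aᶜ).Connected

/-- `v` is a cut vertex: `Γ - v` is disconnected. -/
def IsCutVertex {V : Type*} (Γ : SimpleGraph V) (v : V) : Prop :=
  ¬ (Γ.induce {v}ᶜ).Connected

/-- A block: a maximal `2`-connected subgraph. -/
def IsBlock {V : Type*} (Γ : SimpleGraph V) (B : Γ.Subgraph) : Prop :=
  Maximal (fun H : Γ.Subgraph => IsKConnected H.coe 2) B

/-- The block-cut tree: its vertices are the cut vertices and the blocks of `Γ`, and a cut vertex
`v` is joined to a block `B` when `v ∈ B`. -/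
def blockCutTree {V : Type*} (Γ : SimpleGraph V) :
    SimpleGraph ({v : V // IsCutVertex Γ v} ⊕ {B : Γ.Subgraph // IsBlock Γ B}) :=
  SimpleGraph.fromRel fun x y =>
    match x, y with
    | Sum.inl v, Sum.inr B => v.1 ∈ B.1.verts
    | _, _ => False

/-- Leaf blocks: blocks that are leaves (vertices of degree one) of the block-cut tree. -/
def leafBlocks {V : Type*} (Γ : SimpleGraph V) : Set Γ.Subgraph :=
  {B | ∃ h : IsBlock Γ B, ((blockCutTree Γ).neighborSet (Sum.inr ⟨B, h⟩)).ncard = 1}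

/-- Internal blocks: blocks that are not leaves of the block-cut tree. -/
def internalBlocks {V : Type*} (Γ : SimpleGraph V) : Set Γ.Subgraph :=
  {B | IsBlock Γ B ∧ B ∉ leafBlocks Γ}

/-- Internal cut edges: edges whose two endpoints are the vertex set of an internal block. -/
def internalCutEdges {V : Type*} (Γ : SimpleGraph V) : Set (Sym2 V) :=
  {s | s ∈ Γ.edgeSet ∧ ∃ B ∈ internalBlocks Γ, B.verts = {v | v ∈ s}}

/-- `𝔠(j)`: one less than the number of connected components of `Γ - j`. -/
noncomputable def cutNumber {V : Type*} (Γ : SimpleGraph V) (j : V) : ℤ :=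
  (Nat.card (Γ.induce {j}ᶜ).ConnectedComponent : ℤ) - 1

open Classical in
/-- The number `D_Γ` of a graph `Γ` on `n` vertices. The argument `G` chooses, for each edge `s`,
a connected component `G_s` of `Γ` with `s` deleted. -/
noncomputable def linDim {n : ℕ} (Γ : SimpleGraph (Fin n))
    (G : ∀ s : Sym2 (Fin n), (Γ.deleteEdges {s}).ConnectedComponent) : ℤ :=
  2 * (n : ℤ) - 1
    - ∑ j : Fin n with IsCutVertex Γ j, cutNumber Γ j
    + (n : ℤ) * (((leafBlocks Γ).ncard : ℤ)
        + (({B ∈ internalBlocks Γ | 2 < B.verts.ncard}).ncard : ℤ) - 1)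
    + ∑ s : Sym2 (Fin n) with s ∈ internalCutEdges Γ, (n.choose (G s).supp.ncard : ℤ)

/-! ### Splines -/

/-- The ring of splines on the labelled Cayley graph of `S_n` attached to `Γ`: functions
`ρ : S_n → ℂ[t₁, …, tₙ]` with `ρ(w) - ρ(w (i j)) ∈ ⟨t_{w(i)} - t_{w(j)}⟩` for every edge
`(i, j)` of `Γ`. -/
noncomputable def splines {n : ℕ} (Γ : SimpleGraph (Fin n)) :
    Subalgebra ℂ (Equiv.Perm (Fin n) → MvPolynomial (Fin n) ℂ) where
  carrier := {ρ | ∀ (w : Equiv.Perm (Fin n)) (i j : Fin n), Γ.Adj i j →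
    ρ w - ρ (w * Equiv.swap i j) ∈
      Ideal.span {(MvPolynomial.X (w i) - MvPolynomial.X (w j) : MvPolynomial (Fin n) ℂ)}}
  mul_mem' := by
    intro a b ha hb w i j hij
    have h : (a * b) w - (a * b) (w * Equiv.swap i j)
        = a w * (b w - b (w * Equiv.swap i j))
          + b (w * Equiv.swap i j) * (a w - a (w * Equiv.swap i j)) := by
      simp only [Pi.mul_apply]; ring
    rw [h]
    exact Ideal.add_mem _ (Ideal.mul_mem_left _ _ (hb w i j hij))
      (Ideal.mul_mem_left _ _ (ha w i j hij))
  add_mem' := by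
    intro a b ha hb w i j hij
    have h : (a + b) w - (a + b) (w * Equiv.swap i j)
        = (a w - a (w * Equiv.swap i j)) + (b w - b (w * Equiv.swap i j)) := by
      simp only [Pi.add_apply]; ring
    rw [h]
    exact Ideal.add_mem _ (ha w i j hij) (hb w i j hij)
  algebraMap_mem' := by
    intro r w i j _
    simp [Pi.algebraMap_apply]

/-- The degree `d` piece of the ring of splines. -/
def splinesDeg {n : ℕ} (Γ : SimpleGraph (Fin n)) (d : ℕ) : Submodule ℂ (splines Γ) where
  carrier := {ρ | ∀ w, (ρ.1 w).IsHomogeneous d}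
  zero_mem' := fun _ => MvPolynomial.isHomogeneous_zero _ _ _
  add_mem' := fun ha hb w => (ha w).add (hb w)
  smul_mem' := by
    intro c ρ h w
    have := (MvPolynomial.isHomogeneous_C (Fin n) c).mul (h w)
    simpa [MvPolynomial.smul_eq_C_mul] using this

/-- The spline `t̄ᵢ`, with `t̄ᵢ(w) = tᵢ`. -/
noncomputable def tSpline {n : ℕ} (Γ : SimpleGraph (Fin n)) (i : Fin n) : splines Γ :=
  ⟨fun _ => MvPolynomial.X i, by intro w a b _; simp⟩

/-- The spline `x̄ᵢ`, with `x̄ᵢ(w) = t_{w(i)}`. -/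
noncomputable def xSpline {n : ℕ} (Γ : SimpleGraph (Fin n)) (i : Fin n) : splines Γ :=
  ⟨fun w => MvPolynomial.X (w i), by
    intro w a b _
    rw [Ideal.mem_span_singleton]
    by_cases ha : i = a
    · subst ha; simp
    · by_cases hb : i = b
      · subst hb
        exact ⟨-1, by simp⟩
      · simp [Equiv.swap_apply_of_ne_of_ne ha hb]⟩

/-- The ideal `⟨t̄₁, …, t̄ₙ⟩` of the ring of splines. -/
noncomputable def leftIdeal {n : ℕ} (Γ : SimpleGraph (Fin n)) : Ideal (splines Γ) :=
  Ideal.span (Set.range (tSpline Γ))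

/-- The ideal `⟨x̄₁, …, x̄ₙ⟩` of the ring of splines. -/
noncomputable def rightIdeal {n : ℕ} (Γ : SimpleGraph (Fin n)) : Ideal (splines Γ) :=
  Ideal.span (Set.range (xSpline Γ))

/-- The left quotient `L_Γ`. -/
abbrev LeftQuotient {n : ℕ} (Γ : SimpleGraph (Fin n)) : Type := splines Γ ⧸ leftIdeal Γ

/-- The right quotient `R_Γ`. -/
abbrev RightQuotient {n : ℕ} (Γ : SimpleGraph (Fin n)) : Type := splines Γ ⧸ rightIdeal Γ

/-- The degree `d` piece of `L_Γ`: the image of the degree `d` splines. -/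
noncomputable def leftDeg {n : ℕ} (Γ : SimpleGraph (Fin n)) (d : ℕ) :
    Submodule ℂ (LeftQuotient Γ) :=
  (splinesDeg Γ d).map (Ideal.Quotient.mkₐ ℂ (leftIdeal Γ)).toLinearMap

/-- The degree `d` piece of `R_Γ`: the image of the degree `d` splines. -/
noncomputable def rightDeg {n : ℕ} (Γ : SimpleGraph (Fin n)) (d : ℕ) :
    Submodule ℂ (RightQuotient Γ) :=
  (splinesDeg Γ d).map (Ideal.Quotient.mkₐ ℂ (rightIdeal Γ)).toLinearMap

end CayleySplines

/-! Write a linear spline as `ρ(w) = ∑ v, Φ v w · t_{w(v)}`, indexing coefficients by positions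
rather than by variables. The condition at an edge `(i, j)` then says that exchanging the values of
`w` at `i` and `j` preserves `Φ k` for `k ≠ i, j` and preserves `Φ i + Φ j`. Since `Γ` is connected,
`∑ v, Φ v` is constant, so the dimension is one more than that of the families with zero sum
(`finrank_edgeForms`).

Zero-sum families split over blocks (`IsGateSystem.finrank_zeroSumForms`). Every vertex enters a
block `B` through a unique gate in `B`, which gives a retraction of the vertex set onto `B`. Summing
`Φ` over the fibres of this retraction gives a zero-sum family whose member at `v` depends only on
the image under `w` of the fibre over `v`: both the fibre and its complement are connected, so
exchanges along edges inside them generate all exchanges inside them. Conversely, adding up such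
families over all blocks recovers `Φ`.

It remains to find the dimension for one block. If `|B| = 2`, one of the two functions determines
the other and is an arbitrary function of a subset of fixed size, which gives a binomial coefficient
(`finrank_gateSpace_of_two`). If `|B| ≥ 3`, the family has the form `c v + ∑ μ (w p)`, with `p` in
the fibre over `v`, which gives `n + |B| - 2` (`finrank_gateSpace_of_three_le`). Incidence counts
between vertices and blocks turn the total into `linDim` (`linDim_eq`).

For the quotients, the degree-one part of either ideal is spanned over `ℂ` by its `n` linearly
independent generators, because the constant term of a spline is the same at every `w`. -/

namespace CayleySplines

open Equiv Finset

/-! ### Functions of a permutation invariant under exchanges of positions -/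

section SwapInvariance

variable {V : Type*} [DecidableEq V]

/-- `f` does not change when the values of its argument at `p` and `q` are exchanged. -/
def SwapInvariant (f : Perm V → ℂ) (p q : V) : Prop :=
  ∀ w, f (w * swap p q) = f w

lemma SwapInvariant.refl (f : Perm V → ℂ) (p : V) : SwapInvariant f p p := by
  intro w
  rw [swap_self]
  rfl

lemma SwapInvariant.symm {f : Perm V → ℂ} {p q : V} (h : SwapInvariant f p q) :
    SwapInvariant f q p := by
  intro w
  rw [swap_comm, h]

/-- The transposition of `p` and `r` is a conjugate of one of the two given transpositions by the
other. -/
lemma SwapInvariant.trans {f : Perm V → ℂ} {p q r : V} (h : SwapInvariant f p q)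
    (h' : SwapInvariant f q r) : SwapInvariant f p r := by
  by_cases hpr : p = r
  · subst hpr; exact SwapInvariant.refl _ _
  by_cases hpq : p = q
  · subst hpq; exact h'
  intro w
  rw [swap_comm, ← swap_mul_swap_mul_swap hpq hpr, ← mul_assoc, ← mul_assoc, h', h, h']

lemma SwapInvariant.add {f g : Perm V → ℂ} {p q : V} (hf : SwapInvariant f p q)
    (hg : SwapInvariant g p q) : SwapInvariant (f + g) p q := by
  intro w
  simp only [Pi.add_apply, hf w, hg w]

lemma SwapInvariant.sum {ι : Type*} {s : Finset ι} {f : ι → Perm V → ℂ} {p q : V}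
    (h : ∀ i ∈ s, SwapInvariant (f i) p q) : SwapInvariant (∑ i ∈ s, f i) p q := by
  intro w
  simp only [Finset.sum_apply]
  exact Finset.sum_congr rfl fun i hi => h i hi w

lemma SwapInvariant.smul {f : Perm V → ℂ} {p q : V} (c : ℂ) (hf : SwapInvariant f p q) :
    SwapInvariant (c • f) p q := by
  intro w
  simp only [Pi.smul_apply, hf w]

lemma SwapInvariant.neg {f : Perm V → ℂ} {p q : V} (hf : SwapInvariant f p q) :
    SwapInvariant (-f) p q := by
  intro w
  simp only [Pi.neg_apply, hf w]

/-- Peel the transposition of `x` and `π x` off `π`: the remaining factor has smaller support, and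
its moves stay inside the same classes of exchangeable positions. -/
lemma apply_mul_eq_of_swapInvariant [Fintype V] {f : Perm V → ℂ} (π : Perm V)
    (h : ∀ x, SwapInvariant f x (π x)) (w : Perm V) : f (w * π) = f w := by
  induction hk : #π.support using Nat.strong_induction_on generalizing π w with
  | _ k ih =>
    by_cases hπ : π = 1
    · rw [hπ, mul_one]
    obtain ⟨x, hx⟩ : ∃ x, π x ≠ x := by
      by_contra! hx
      exact hπ (Perm.ext hx)
    have hlt := Perm.card_support_swap_mul hx
    have hinv : ∀ y, SwapInvariant f y ((swap x (π x) * π) y) := by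
      intro y
      rw [Perm.mul_apply]
      by_cases h1 : π y = x
      · rw [h1, swap_apply_left]
        exact (h1 ▸ h y : SwapInvariant f y x).trans (h x)
      · by_cases h2 : π y = π x
        · rw [h2, swap_apply_right, π.injective h2]
          exact SwapInvariant.refl _ _
        · rw [swap_apply_of_ne_of_ne h1 h2]
          exact h y
    have h1 := ih _ (hk ▸ hlt) (swap x (π x) * π) hinv (w * swap x (π x)) rfl
    rw [h x w] at h1
    rw [← h1, mul_assoc, ← mul_assoc (swap x (π x)), swap_mul_self, one_mul]

lemma apply_eq_apply_of_swapInvariant [Fintype V] {f : Perm V → ℂ}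
    (h : ∀ p q, SwapInvariant f p q) (w w' : Perm V) : f w = f w' := by
  have := apply_mul_eq_of_swapInvariant (w'⁻¹ * w) (fun x => h x _) w'
  rwa [mul_inv_cancel_left] at this

lemma swap_mul_apply_eq {w : Perm V} {y y' z z' : V} (h : y ≠ z) (h' : y' ≠ z') (hw : w y = y') :
    (swap (w z) z' * w) y = y' := by
  rw [Perm.mul_apply, hw, swap_apply_of_ne_of_ne _ h']
  rw [← hw]
  exact fun e => h (w.injective e)

lemma exists_perm_two {a b a' b' : V} (hab : a ≠ b) (hab' : a' ≠ b') :
    ∃ w : Perm V, w a = a' ∧ w b = b' :=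
  ⟨swap (swap a a' b) b' * swap a a', swap_mul_apply_eq hab hab' (swap_apply_left _ _),
    by rw [Perm.mul_apply, swap_apply_left]⟩

lemma exists_perm_three {a b c a' b' c' : V} (hab : a ≠ b) (hac : a ≠ c) (hbc : b ≠ c)
    (hab' : a' ≠ b') (hac' : a' ≠ c') (hbc' : b' ≠ c') :
    ∃ w : Perm V, w a = a' ∧ w b = b' ∧ w c = c' := by
  obtain ⟨w, ha, hb⟩ := exists_perm_two hab hab'
  exact ⟨swap (w c) c' * w, swap_mul_apply_eq hac hac' ha, swap_mul_apply_eq hbc hbc' hb,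
    by rw [Perm.mul_apply, swap_apply_left]⟩

end SwapInvariance

/-! ### Functions of the image of a fixed set of positions -/

section SubsetFunctions

variable {V : Type*} [Fintype V] [DecidableEq V]

/-- Functions of a permutation `w` that depend only on the image of `H` under `w`. -/
def subsetFunctions (H : Finset V) : Submodule ℂ (Perm V → ℂ) where
  carrier := {f | ∀ p q, (p ∈ H ↔ q ∈ H) → SwapInvariant f p q}
  zero_mem' := fun _ _ _ _ => rfl
  add_mem' := fun hf hg p q h => (hf p q h).add (hg p q h)
  smul_mem' := fun c _ hf p q h => (hf p q h).smul c

/-- Such functions are the pullbacks along `w ↦ w(H)`, which maps onto all subsets of size `#H`. Two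
permutations with the same image of `H` differ by a right factor preserving `H`. -/
lemma finrank_subsetFunctions (H : Finset V) :
    Module.finrank ℂ (subsetFunctions H) = (Fintype.card V).choose #H := by
  classical
  let T := {S : Finset V // #S = #H}
  let im : Perm V → T := fun w => ⟨H.map w.toEmbedding, by simp⟩
  have him : ∀ w p q, (p ∈ H ↔ q ∈ H) → im (w * swap p q) = im w := by
    intro w p q h
    apply Subtype.ext
    ext x
    simp only [im, mem_map_equiv]
    change (w * swap p q)⁻¹ x ∈ H ↔ w⁻¹ x ∈ H
    rw [mul_inv_rev, swap_inv, Perm.mul_apply]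
    by_cases h1 : w⁻¹ x = p
    · rw [h1, swap_apply_left, h]
    by_cases h2 : w⁻¹ x = q
    · rw [h2, swap_apply_right, h]
    rw [swap_apply_of_ne_of_ne h1 h2]
  have hsurj : Function.Surjective im := by
    rintro ⟨S, hS⟩
    obtain ⟨e⟩ : Nonempty ({x // x ∈ H} ≃ {x // x ∈ S}) :=
      Fintype.card_eq.mp (by simp [hS])
    refine ⟨e.extendSubtype, Subtype.ext ?_⟩
    apply Finset.eq_of_subset_of_card_le
    · intro x hx
      simp only [im, mem_map, Equiv.coe_toEmbedding] at hx
      obtain ⟨a, ha, rfl⟩ := hx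
      exact e.extendSubtype_mem a ha
    · simp [im, hS]
  let φ : (T → ℂ) →ₗ[ℂ] subsetFunctions H :=
    { toFun := fun f => ⟨fun w => f (im w), fun p q h w => by simp only [him w p q h]⟩
      map_add' := fun _ _ => rfl
      map_smul' := fun _ _ => rfl }
  have hφ : Function.Bijective φ := by
    constructor
    · intro f f' h
      funext t
      obtain ⟨w, rfl⟩ := hsurj t
      exact congrFun (congrArg Subtype.val h) w
    · rintro ⟨f, hf⟩
      refine ⟨fun t => f (hsurj t).choose, Subtype.ext ?_⟩
      funext w
      change f (hsurj (im w)).choose = f w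
      set w' := (hsurj (im w)).choose
      have hw' : im w' = im w := (hsurj (im w)).choose_spec
      have := apply_mul_eq_of_swapInvariant (f := f) (w'⁻¹ * w) (fun x => hf _ _ ?_) w'
      · rw [mul_inv_cancel_left] at this
        exact this.symm
      · have h1 : w x ∈ H.map w.toEmbedding ↔ w x ∈ H.map w'.toEmbedding := by
          rw [show H.map w'.toEmbedding = H.map w.toEmbedding from congrArg Subtype.val hw']
        rw [mem_map_equiv, mem_map_equiv, symm_apply_apply] at h1
        exact h1
  rw [← (LinearEquiv.ofBijective φ hφ).finrank_eq, Module.finrank_fintype_fun_eq_card]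
  simp [T, Fintype.card_finset_len]

end SubsetFunctions

end CayleySplines

namespace CayleySplines

open Equiv Finset

/-! ### Zero-sum families attached to a retraction: two fixed points, and exchange differences -/

section GateSpace

variable {V : Type*} [Fintype V] [DecidableEq V]

/-- Families `F`, indexed by the fixed points of a retraction `g`, of functions of a permutation
`w` such that `F v` depends only on the image under `w` of the fibre of `g` over `v`, and such that
the sum of the family is zero. -/
def gateSpace (g : V → V) : Submodule ℂ (V → Perm V → ℂ) where
  carrier := {F | (∀ v, g v ≠ v → F v = 0) ∧
    (∀ v p q, (g p = v ↔ g q = v) → SwapInvariant (F v) p q) ∧ ∑ v, F v = 0}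
  zero_mem' := ⟨fun _ _ => rfl, fun _ _ _ _ _ => rfl, by simp⟩
  add_mem' := by
    rintro F F' ⟨h1, h2, h3⟩ ⟨h1', h2', h3'⟩
    refine ⟨fun v hv => ?_, fun v p q h => (h2 v p q h).add (h2' v p q h), ?_⟩
    · rw [Pi.add_apply, h1 v hv, h1' v hv, add_zero]
    · simp only [Pi.add_apply, sum_add_distrib, h3, h3', add_zero]
  smul_mem' := by
    rintro c F ⟨h1, h2, h3⟩
    refine ⟨fun v hv => ?_, fun v p q h => (h2 v p q h).smul c, ?_⟩
    · rw [Pi.smul_apply, h1 v hv, smul_zero]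
    · simp only [Pi.smul_apply, ← smul_sum, h3, smul_zero]

/-- The zero sum forces `F j = -F i`. This adds no condition on `F i`, since the two fibres are
complementary and hence have the same invariances. -/
lemma finrank_gateSpace_of_two {g : V → V} {i j : V} (hij : i ≠ j)
    (hi : g i = i) (hj : g j = j) (h : ∀ v, g v = i ∨ g v = j) :
    Module.finrank ℂ (gateSpace g) = (Fintype.card V).choose #{v | g v = i} := by
  rw [← finrank_subsetFunctions]
  let φ : gateSpace g →ₗ[ℂ] subsetFunctions (V := V) {v | g v = i} :=
    { toFun := fun F => ⟨F.1 i, fun p q hpq => F.2.2.1 i p q (by simpa using hpq)⟩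
      map_add' := fun _ _ => rfl
      map_smul' := fun _ _ => rfl }
  have hfix : ∀ v, v ≠ i → v ≠ j → g v ≠ v := by
    intro v h1 h2 hv
    rcases h v with h | h <;> rw [hv] at h <;> contradiction
  refine (LinearEquiv.ofBijective φ ⟨?_, ?_⟩).finrank_eq
  · intro F F' hF
    have hFi : F.1 i = F'.1 i := congrArg Subtype.val hF
    have hsum : ∀ F : gateSpace g, F.1 i + F.1 j = 0 := by
      intro F
      rw [← F.2.2.2, ← Finset.sum_pair hij]
      refine Finset.sum_subset (subset_univ _) fun v _ hv => ?_
      simp only [mem_insert, mem_singleton, not_or] at hv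
      exact F.2.1 v (hfix v hv.1 hv.2)
    refine Subtype.ext (funext fun v => ?_)
    by_cases h1 : v = i
    · rw [h1, hFi]
    by_cases h2 : v = j
    · rw [h2, eq_neg_of_add_eq_zero_right (hsum F), eq_neg_of_add_eq_zero_right (hsum F'), hFi]
    rw [F.2.1 v (hfix v h1 h2), F'.2.1 v (hfix v h1 h2)]
  · rintro ⟨f, hf⟩
    have hf' : ∀ p q, (g p = i ↔ g q = i) → SwapInvariant f p q :=
      fun p q hpq => hf p q (by simpa using hpq)
    have hi' : ∀ p, g p = i ↔ ¬ g p = j := by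
      intro p
      rcases h p with h | h <;> simp [h, hij, hij.symm]
    refine ⟨⟨fun v => if v = i then f else if v = j then -f else 0, ?_, ?_, ?_⟩, ?_⟩
    · intro v hv
      have h1 : v ≠ i := by rintro rfl; exact hv hi
      have h2 : v ≠ j := by rintro rfl; exact hv hj
      simp [h1, h2]
    · intro v p q hpq
      by_cases h1 : v = i
      · subst h1
        simpa using hf' p q hpq
      by_cases h2 : v = j
      · subst h2
        simp only [h1, if_false, if_true]
        exact (hf' p q (by rw [hi', hi', hpq])).neg
      · simp only [h1, h2, if_false]
        exact fun _ => rfl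
    · rw [← Finset.sum_subset (subset_univ {i, j}), Finset.sum_pair hij]
      · simp [hij.symm]
      · intro v _ hv
        simp only [mem_insert, mem_singleton, not_or] at hv
        simp [hv.1, hv.2]
    · exact Subtype.ext (by simp [φ])

/-- The sum is minus the sum of the other members, whose fibres contain neither `p` nor `q`. -/
lemma add_swapInvariant_of_mem_gateSpace {g : V → V} {F : V → Perm V → ℂ} (hF : F ∈ gateSpace g)
    {u v p q : V} (huv : u ≠ v) (hp : g p = u ∨ g p = v) (hq : g q = u ∨ g q = v) :
    SwapInvariant (F u + F v) p q := by
  have h := hF.2.2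
  rw [← Finset.sum_add_sum_compl {u, v}, Finset.sum_pair huv] at h
  rw [eq_neg_of_add_eq_zero_left h]
  refine (SwapInvariant.sum fun x hx => hF.2.1 x p q ?_).neg
  simp only [mem_compl, mem_insert, mem_singleton, not_or] at hx
  have h1 : ∀ p, g p = u ∨ g p = v → g p ≠ x := by
    rintro p (h | h) rfl
    · exact hx.1 h
    · exact hx.2 h
  simp [h1 p hp, h1 q hq]

/-- If `g` has at least three fixed points, the exchange differences of an element of
`gateSpace g` depend only on the exchanged values. -/
lemma exchange_difference_congr {g : V → V} (hthird : ∀ u v, ∃ x, g x = x ∧ x ≠ u ∧ x ≠ v)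
    {F : V → Perm V → ℂ} (hF : F ∈ gateSpace g) {p q : V} {w w' : Perm V} (hpq : g p ≠ g q)
    (hp : w p = w' p) (hq : w q = w' q) :
    F (g p) w - F (g p) (w * swap p q) = F (g p) w' - F (g p) (w' * swap p q) := by
  let D : Perm V → ℂ := fun w => F (g p) w - F (g p) (w * swap p q)
  have hD : ∀ w, D w = -(F (g q) w - F (g q) (w * swap p q)) := by
    intro w
    have := add_swapInvariant_of_mem_gateSpace hF hpq (p := p) (q := q) (Or.inl rfl)
      (Or.inr rfl) w
    simp only [Pi.add_apply] at this
    simp only [D]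
    linear_combination -this
  have hcomm : ∀ a b, a ≠ p → a ≠ q → b ≠ p → b ≠ q → ∀ w : Perm V,
      w * swap a b * swap p q = w * swap p q * swap a b := by
    intro a b h1 h2 h3 h4 w
    rw [mul_assoc, mul_assoc]
    rw [mul_swap_eq_swap_mul, swap_apply_of_ne_of_ne h1.symm h3.symm,
      swap_apply_of_ne_of_ne h2.symm h4.symm]
  have hu : ∀ a b, a ≠ p → a ≠ q → b ≠ p → b ≠ q → (g a = g p ↔ g b = g p) →
      SwapInvariant D a b := by
    intro a b h1 h2 h3 h4 hab w
    simp only [D]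
    rw [hcomm a b h1 h2 h3 h4, hF.2.1 _ _ _ hab, hF.2.1 _ _ _ hab]
  have hv : ∀ a b, a ≠ p → a ≠ q → b ≠ p → b ≠ q → (g a = g q ↔ g b = g q) →
      SwapInvariant D a b := by
    intro a b h1 h2 h3 h4 hab w
    rw [hD, hD, hcomm a b h1 h2 h3 h4, hF.2.1 _ _ _ hab, hF.2.1 _ _ _ hab]
  obtain ⟨x, hx, hxp, hxq⟩ := hthird (g p) (g q)
  have hxp' : x ≠ p := by rintro rfl; exact hxp hx.symm
  have hxq' : x ≠ q := by rintro rfl; exact hxq hx.symm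
  -- Here `D` has two expressions, through `F (g p)` and through `F (g q)`. A position in the fibre
  -- of `p` can be exchanged with the third point `x` in the second expression, any other position
  -- in the first.
  have htox : ∀ a, a ≠ p → a ≠ q → SwapInvariant D a x := by
    intro a h1 h2
    by_cases ha : g a = g p
    · exact hv a x h1 h2 hxp' hxq' (by rw [ha, hx]; simp [hpq, hxq])
    · exact hu a x h1 h2 hxp' hxq' (by rw [hx]; simp [ha, hxp])
  have := apply_mul_eq_of_swapInvariant (f := D) (w⁻¹ * w') (fun y => ?_) w
  · rw [mul_inv_cancel_left] at this
    exact this.symm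
  · have e1 : (w⁻¹ * w') p = p := by
      rw [Perm.mul_apply, ← hp, ← Perm.mul_apply, inv_mul_cancel, Perm.one_apply]
    have e2 : (w⁻¹ * w') q = q := by
      rw [Perm.mul_apply, ← hq, ← Perm.mul_apply, inv_mul_cancel, Perm.one_apply]
    by_cases y1 : y = p
    · rw [y1, e1]; exact SwapInvariant.refl _ _
    by_cases y2 : y = q
    · rw [y2, e2]; exact SwapInvariant.refl _ _
    refine (htox y y1 y2).trans (htox _ ?_ ?_).symm
    · exact fun e => y1 ((w⁻¹ * w').injective (e.trans e1.symm))
    · exact fun e => y2 ((w⁻¹ * w').injective (e.trans e2.symm))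

/-- The difference depends only on the values `w p`, `w q`, and also not on the positions: moves
within a fibre (`hp`), moves of the second position (`hq`) and reversal (`hflip`) bring every pair
of positions to the reference pair `(x₀, x₁)`. -/
lemma exists_exchange_difference {g : V → V} (hthird : ∀ u v, ∃ x, g x = x ∧ x ≠ u ∧ x ≠ v)
    {x₀ x₁ : V} (h₀ : g x₀ = x₀) (h₁ : g x₁ = x₁) (h₀₁ : x₀ ≠ x₁)
    {F : V → Perm V → ℂ} (hF : F ∈ gateSpace g) :
    ∃ δ : V → V → ℂ, ∀ p q w, g p ≠ g q →
      F (g p) w - F (g p) (w * swap p q) = δ (w p) (w q) := by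
  have hdep := @exchange_difference_congr V _ _ g hthird F hF
  have hq : ∀ p q q' w, g p ≠ g q → g p ≠ g q' →
      F (g p) w - F (g p) (w * swap p q) =
        F (g p) (w * swap q q') - F (g p) (w * swap q q' * swap p q') := by
    intro p q q' w h h'
    have e := hF.2.1 (g p) q q' (by simp [h.symm, h'.symm])
    have hpq : p ≠ q := fun e => h (e ▸ rfl)
    have hpq' : p ≠ q' := fun e => h' (e ▸ rfl)
    rw [e w, show w * swap q q' * swap p q' = w * swap p q * swap q q' from ?_, e]
    rw [mul_assoc, mul_assoc, mul_swap_eq_swap_mul]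
    simp [swap_apply_of_ne_of_ne hpq hpq']
  have hp : ∀ p p' q w, g p = g p' → g p ≠ g q →
      F (g p) w - F (g p) (w * swap p q) =
        F (g p') (w * swap p p') - F (g p') (w * swap p p' * swap p' q) := by
    intro p p' q w h h'
    have e := hF.2.1 (g p) p p' (by simp [h])
    have hpq : q ≠ p := fun e => h' (e ▸ rfl)
    have hpq' : q ≠ p' := fun e => h' (e ▸ h)
    rw [← h, e w, show w * swap p p' * swap p' q = w * swap p q * swap p p' from ?_, e]
    rw [mul_assoc, mul_assoc, mul_swap_eq_swap_mul]
    simp [swap_apply_of_ne_of_ne hpq hpq']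
  have hflip : ∀ p q w, g p ≠ g q → F (g p) w - F (g p) (w * swap p q) =
      F (g q) (w * swap p q) - F (g q) (w * swap p q * swap q p) := by
    intro p q w hpq
    have := add_swapInvariant_of_mem_gateSpace hF hpq (p := p) (q := q) (Or.inl rfl)
      (Or.inr rfl) w
    simp only [Pi.add_apply] at this
    rw [swap_comm q p, mul_assoc, swap_mul_self, mul_one]
    linear_combination -this
  let P : V → V → ℂ → Prop := fun a b c => ∀ w : Perm V, w x₀ = a → w x₁ = b →
    F x₀ w - F x₀ (w * swap x₀ x₁) = c
  have base : ∀ p q w, g p ≠ g q → g p = x₀ →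
      P (w p) (w q) (F (g p) w - F (g p) (w * swap p q)) := by
    intro p q w hpq hp0 w' e1 e2
    have a1 := hp p x₀ q w (hp0.trans h₀.symm) hpq
    have hxq : x₀ ≠ q := by rintro rfl; exact hpq (hp0.trans h₀.symm)
    have hpq' : p ≠ q := fun e => hpq (e ▸ rfl)
    have a2 := hq x₀ q x₁ (w * swap p x₀) (by rw [h₀, ← hp0]; exact hpq) (by rwa [h₀, h₁])
    rw [a1, a2]
    have a3 := hdep (p := x₀) (q := x₁) (w := w') (w' := w * swap p x₀ * swap q x₁)
      (by rwa [h₀, h₁]) ?_ ?_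
    · rw [h₀] at a3 ⊢; exact a3
    · rw [e1, Perm.mul_apply, Perm.mul_apply, swap_apply_of_ne_of_ne hxq h₀₁, swap_apply_right]
    · rw [e2, Perm.mul_apply, Perm.mul_apply, swap_apply_right,
        swap_apply_of_ne_of_ne hpq'.symm hxq.symm]
  have all : ∀ p q w, g p ≠ g q → P (w p) (w q) (F (g p) w - F (g p) (w * swap p q)) := by
    intro p q w hpq
    by_cases hp0 : g p = x₀
    · exact base p q w hpq hp0
    have hpq' : p ≠ q := fun e => hpq (e ▸ rfl)
    have hpx : p ≠ x₀ := by rintro rfl; exact hp0 h₀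
    -- When `p` lies outside the fibre of `x₀`, the second position may be moved to `x₀`; reversing
    -- the pair then puts `x₀` first, as `base` requires.
    have hp0' : g p ≠ g x₀ := by rwa [h₀]
    rw [hq p q x₀ w hpq hp0', hflip p x₀ _ hp0']
    have b := base x₀ p (w * swap q x₀ * swap p x₀) hp0'.symm h₀
    have c1 : (w * swap q x₀ * swap p x₀) x₀ = w p := by
      rw [Perm.mul_apply, Perm.mul_apply, swap_apply_right, swap_apply_of_ne_of_ne hpq' hpx]
    have c2 : (w * swap q x₀ * swap p x₀) p = w q := by
      rw [Perm.mul_apply, Perm.mul_apply, swap_apply_left, swap_apply_right]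
    rwa [c1, c2] at b
  have hex : ∀ a b, ∃ c, a ≠ b → ∀ w : Perm V, w x₀ = a → w x₁ = b →
      F x₀ w - F x₀ (w * swap x₀ x₁) = c := by
    intro a b
    by_cases hw : ∃ w : Perm V, w x₀ = a ∧ w x₁ = b
    · obtain ⟨w, rfl, rfl⟩ := hw
      exact ⟨_, fun _ => by simpa [h₀] using base x₀ x₁ w (by rwa [h₀, h₁]) h₀⟩
    · exact ⟨0, fun _ w e1 e2 => absurd ⟨w, e1, e2⟩ hw⟩
  choose δ hδ using hex
  refine ⟨δ, fun p q w hpq => ?_⟩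
  have hpq' : w p ≠ w q := fun e => hpq (by rw [w.injective e])
  obtain ⟨w', e1, e2⟩ := exists_perm_two h₀₁ hpq'
  rw [← hδ _ _ hpq' w' e1 e2, all p q w hpq w' e1 e2]

end GateSpace

end CayleySplines

namespace CayleySplines

open Equiv Finset

/-! ### Zero-sum families for at least three fixed points -/

section GateSpace

variable {V : Type*} [Fintype V] [DecidableEq V]

/-- Exchanging back gives antisymmetry of `δ`. Exchanging among three fibres gives the cocycle
identity, so `δ` is a coboundary. -/
lemma exists_potential {g : V → V} (hthird : ∀ u v, ∃ x, g x = x ∧ x ≠ u ∧ x ≠ v)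
    {x₀ x₁ : V} (h₀ : g x₀ = x₀) (h₁ : g x₁ = x₁) (h₀₁ : x₀ ≠ x₁)
    {F : V → Perm V → ℂ} (hF : F ∈ gateSpace g) :
    ∃ μ : V → ℂ, ∀ p q w, g p ≠ g q →
      F (g p) w - F (g p) (w * swap p q) = μ (w p) - μ (w q) := by
  obtain ⟨δ, hδ⟩ := exists_exchange_difference hthird h₀ h₁ h₀₁ hF
  obtain ⟨x₂, h₂, h₂₀, h₂₁⟩ := hthird x₀ x₁
  have anti : ∀ a b, a ≠ b → δ b a = -δ a b := by
    intro a b hab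
    obtain ⟨w, rfl, rfl⟩ := exists_perm_two h₀₁ hab
    have e1 := hδ x₀ x₁ w (by rwa [h₀, h₁])
    have e2 := hδ x₀ x₁ (w * swap x₀ x₁) (by rwa [h₀, h₁])
    rw [mul_assoc, swap_mul_self, mul_one, Perm.mul_apply, Perm.mul_apply, swap_apply_left,
      swap_apply_right] at e2
    rw [← e1, ← e2]
    ring
  have cocycle : ∀ a b c, a ≠ b → a ≠ c → b ≠ c → δ a b + δ b c = δ a c := by
    intro a b c hab hac hbc
    obtain ⟨w, rfl, rfl, rfl⟩ := exists_perm_three h₀₁ h₂₀.symm h₂₁.symm hab hac hbc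
    have e1 := hδ x₀ x₁ w (by rwa [h₀, h₁])
    have e2 := hδ x₀ x₂ (w * swap x₀ x₁) (by rw [h₀, h₂]; exact h₂₀.symm)
    have e3 := hδ x₀ x₂ w (by rw [h₀, h₂]; exact h₂₀.symm)
    have e4 : w * swap x₀ x₁ * swap x₀ x₂ = w * swap x₀ x₂ * swap x₂ x₁ := by
      rw [mul_assoc, mul_assoc, mul_swap_eq_swap_mul (swap x₀ x₂), swap_apply_right,
        swap_apply_of_ne_of_ne h₀₁.symm h₂₁.symm]
    rw [e4, hF.2.1 (g x₀) x₂ x₁ (by rw [h₀, h₁, h₂]; simp [h₂₀, h₀₁.symm]), Perm.mul_apply,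
      Perm.mul_apply, swap_apply_left, swap_apply_of_ne_of_ne h₂₀ h₂₁] at e2
    rw [← e1, ← e2, ← e3]
    ring
  -- Here `x₀` serves as a base value. The diagonal value `δ x₀ x₀` is uncontrolled, so the
  -- potential there is set to 0.
  refine ⟨fun a => if a = x₀ then 0 else δ a x₀, fun p q w hpq => ?_⟩
  have hpq' : w p ≠ w q := fun e => hpq (by rw [w.injective e])
  rw [hδ p q w hpq]
  beta_reduce
  by_cases h1 : w p = x₀
  · have h2 : w q ≠ x₀ := fun e => hpq' (h1.trans e.symm)
    rw [if_pos h1, if_neg h2, h1, anti _ _ h2]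
    ring
  by_cases h2 : w q = x₀
  · rw [if_pos h2, if_neg h1, h2, sub_zero]
  · rw [if_neg h1, if_neg h2, ← cocycle _ _ _ hpq' h1 h2]
    ring

/-- The sum of `μ` over the image under `w` of the fibre of `g` over `v`. -/
def fiberSum (g : V → V) (μ : V → ℂ) (v : V) (w : Perm V) : ℂ := ∑ p with g p = v, μ (w p)

lemma fiberSum_swapInvariant (g : V → V) (μ : V → ℂ) {v p q : V} (h : g p = v ↔ g q = v) :
    SwapInvariant (fiberSum g μ v) p q := by
  intro w
  simp only [fiberSum, Finset.sum_filter]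
  rw [← Equiv.sum_comp (swap p q)]
  refine Finset.sum_congr rfl fun x _ => ?_
  rw [Perm.mul_apply, swap_apply_self]
  congr 1
  by_cases h1 : x = p
  · rw [h1, swap_apply_left, eq_iff_iff, h]
  by_cases h2 : x = q
  · rw [h2, swap_apply_right, eq_iff_iff, h]
  rw [swap_apply_of_ne_of_ne h1 h2]

lemma fiberSum_sub_swap (g : V → V) (μ : V → ℂ) {p q : V} (h : g p ≠ g q) (w : Perm V) :
    fiberSum g μ (g p) w - fiberSum g μ (g p) (w * swap p q) = μ (w p) - μ (w q) := by
  have hp : p ∈ ({x | g x = g p} : Finset V) := by simp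
  simp only [fiberSum]
  rw [← Finset.add_sum_erase _ _ hp, ← Finset.add_sum_erase _ _ hp, Perm.mul_apply,
    swap_apply_left]
  have : ∑ x ∈ ({x | g x = g p} : Finset V).erase p, μ ((w * swap p q) x)
      = ∑ x ∈ ({x | g x = g p} : Finset V).erase p, μ (w x) := by
    refine Finset.sum_congr rfl fun x hx => ?_
    simp only [mem_erase, mem_filter, mem_univ, true_and] at hx
    rw [Perm.mul_apply, swap_apply_of_ne_of_ne hx.1]
    rintro rfl
    exact h hx.2.symm
  rw [this]
  ring

lemma sum_fiberSum (g : V → V) (μ : V → ℂ) (w : Perm V) :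
    ∑ v, fiberSum g μ v w = ∑ a, μ a := by
  simp only [fiberSum]
  rw [Finset.sum_fiberwise, Equiv.sum_comp w μ]

/-- The fibre sum of the potential has the same exchange differences as `F v`, so subtracting it
leaves a function invariant under every exchange, hence a constant. -/
lemma exists_eq_add_fiberSum {g : V → V} (h3 : 3 ≤ #{v | g v = v})
    {F : V → Perm V → ℂ} (hF : F ∈ gateSpace g) :
    ∃ (c μ : V → ℂ), ∀ v, g v = v → ∀ w, F v w = c v + fiberSum g μ v w := by
  obtain ⟨x₀, h₀, x₁, h₁, x₂, h₂, h₀₁, h₀₂, h₁₂⟩ := Finset.two_lt_card.mp h3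
  simp only [mem_filter, mem_univ, true_and] at h₀ h₁ h₂
  have hthird : ∀ u v, ∃ x, g x = x ∧ x ≠ u ∧ x ≠ v := by
    intro u v
    by_contra! hx
    have a₀ := or_iff_not_imp_left.mpr (hx x₀ h₀)
    have a₁ := or_iff_not_imp_left.mpr (hx x₁ h₁)
    have a₂ := or_iff_not_imp_left.mpr (hx x₂ h₂)
    rcases a₀ with a₀ | a₀ <;> rcases a₁ with a₁ | a₁
    · exact h₀₁ (a₀.trans a₁.symm)
    · rcases a₂ with a₂ | a₂
      · exact h₀₂ (a₀.trans a₂.symm)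
      · exact h₁₂ (a₁.trans a₂.symm)
    · rcases a₂ with a₂ | a₂
      · exact h₁₂ (a₁.trans a₂.symm)
      · exact h₀₂ (a₀.trans a₂.symm)
    · exact h₀₁ (a₀.trans a₁.symm)
  obtain ⟨μ, hμ⟩ := exists_potential hthird h₀ h₁ h₀₁ hF
  refine ⟨fun v => F v 1 - fiberSum g μ v 1, μ, fun v hv w => ?_⟩
  have hcross : ∀ p q, g p = v → g q ≠ v → SwapInvariant (F v - fiberSum g μ v) p q := by
    rintro p q rfl hq w
    simp only [Pi.sub_apply]
    linear_combination fiberSum_sub_swap g μ (Ne.symm hq) w - hμ p q w (Ne.symm hq)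
  have := apply_eq_apply_of_swapInvariant (f := F v - fiberSum g μ v) (fun p q => ?_) w 1
  · simp only [Pi.sub_apply] at this
    linear_combination this
  · by_cases hp : g p = v
    · by_cases hq : g q = v
      · have e : g p = v ↔ g q = v := by simp [hp, hq]
        rw [sub_eq_add_neg]
        exact (hF.2.1 v p q e).add (fiberSum_swapInvariant g μ e).neg
      · exact hcross p q hp hq
    · by_cases hq : g q = v
      · exact (hcross q p hq hp).symm
      · have e : g p = v ↔ g q = v := by simp [hp, hq]
        rw [sub_eq_add_neg]
        exact (hF.2.1 v p q e).add (fiberSum_swapInvariant g μ e).neg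

/-- The parameters `(c, μ)` span dimension `#{v | g v = v} + |V|`. One is lost to the zero-sum
condition `τ = 0`, and one to the kernel of the parametrisation `Θ`. -/
lemma finrank_gateSpace_of_three_le {g : V → V} (hg : ∀ v, g (g v) = g v)
    (h3 : 3 ≤ #{v | g v = v}) :
    Module.finrank ℂ (gateSpace g) + 2 = Fintype.card V + #{v | g v = v} := by
  let Θ : (({v // g v = v} → ℂ) × (V → ℂ)) →ₗ[ℂ] (V → Perm V → ℂ) :=
    { toFun := fun x v w => (if h : g v = v then x.1 ⟨v, h⟩ else 0) + fiberSum g x.2 v w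
      map_add' := by
        intro x y
        funext v w
        by_cases h : g v = v <;>
          simp only [h, fiberSum, Prod.fst_add, Prod.snd_add, Pi.add_apply, sum_add_distrib,
            dite_true, dite_false] <;> ring
      map_smul' := by
        intro c x
        funext v w
        by_cases h : g v = v <;>
          simp [h, fiberSum, ← Finset.mul_sum, mul_add] }
  let τ : Module.Dual ℂ (({v // g v = v} → ℂ) × (V → ℂ)) :=
    { toFun := fun x => ∑ v, x.1 v + ∑ a, x.2 a
      map_add' := by
        intro x y
        simp only [Prod.fst_add, Prod.snd_add, Pi.add_apply, sum_add_distrib]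
        ring
      map_smul' := by
        intro c x
        simp [← Finset.mul_sum, mul_add] }
  have hsum : ∀ x w, ∑ v, Θ x v w = τ x := by
    intro x w
    change ∑ v, ((if h : g v = v then x.1 ⟨v, h⟩ else 0) + fiberSum g x.2 v w) = _
    rw [Finset.sum_add_distrib, sum_fiberSum]
    change _ = ∑ v, x.1 v + ∑ a, x.2 a
    congr 1
    rw [Finset.sum_dite, Finset.sum_const_zero, add_zero]
    refine Finset.sum_bij (fun v _ => ⟨v.1, (mem_filter.mp v.2).2⟩) (by simp) ?_ ?_ (by simp)
    · rintro ⟨a, ha⟩ _ ⟨b, hb⟩ _ h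
      simpa using h
    · rintro ⟨b, hb⟩ _
      exact ⟨⟨b, by simpa using hb⟩, by simp, rfl⟩
  obtain ⟨x₀, h₀, x₁, h₁, x₂, h₂, h₀₁, h₀₂, h₁₂⟩ := Finset.two_lt_card.mp h3
  simp only [mem_filter, mem_univ, true_and] at h₀ h₁ h₂
  have hτ : τ ≠ 0 := by
    intro h
    have : τ (Pi.single ⟨x₀, h₀⟩ 1, 0) = 0 := by rw [h]; rfl
    simp [τ] at this
  have hker := Module.Dual.finrank_ker_add_one_of_ne_zero hτ
  have hE : Module.finrank ℂ (({v // g v = v} → ℂ) × (V → ℂ)) =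
      #{v | g v = v} + Fintype.card V := by
    simp [Module.finrank_prod, Fintype.card_subtype]
  have hrange : LinearMap.range (Θ.domRestrict (LinearMap.ker τ)) = gateSpace g := by
    apply le_antisymm
    · rintro _ ⟨⟨x, hx⟩, rfl⟩
      refine ⟨fun v hv => ?_, fun v p q hpq w => ?_, ?_⟩
      · funext w
        change (if h : g v = v then x.1 ⟨v, h⟩ else 0) + fiberSum g x.2 v w = 0
        rw [dif_neg hv, zero_add]
        refine Finset.sum_eq_zero fun p hp => ?_
        simp only [mem_filter, mem_univ, true_and] at hp
        exact absurd (hp ▸ hg p) hv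
      · change (if h : g v = v then x.1 ⟨v, h⟩ else 0) + _ =
          (if h : g v = v then x.1 ⟨v, h⟩ else 0) + _
        exact congrArg _ (fiberSum_swapInvariant g x.2 hpq w)
      · funext w
        rw [Finset.sum_apply]
        exact (hsum x w).trans hx
    · intro F hF
      obtain ⟨c, μ, h⟩ := exists_eq_add_fiberSum h3 hF
      have hΘ : Θ (fun v => c v, μ) = F := by
        funext v w
        change (if h : g v = v then c v else 0) + fiberSum g μ v w = F v w
        by_cases hv : g v = v
        · rw [dif_pos hv, h v hv]
        · rw [dif_neg hv, hF.1 v hv, zero_add]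
          refine Finset.sum_eq_zero fun p hp => ?_
          simp only [mem_filter, mem_univ, true_and] at hp
          exact absurd (hp ▸ hg p) hv
      refine ⟨⟨(fun v => c v, μ), ?_⟩, hΘ⟩
      rw [LinearMap.mem_ker, ← hsum _ 1, hΘ, ← Finset.sum_apply, hF.2.2]
      rfl
  have hk : Module.finrank ℂ (LinearMap.ker (Θ.domRestrict (LinearMap.ker τ))) = 1 := by
    -- A constant `μ` contributes the size of each fibre, which the constants `c` can cancel. This
    -- is the only redundancy, since exchange differences determine `μ` up to a constant.
    let k : (({v // g v = v} → ℂ) × (V → ℂ)) := (fun v => -(#{p | g p = v.1} : ℂ), fun _ => 1)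
    have hΘk : Θ k = 0 := by
      funext v w
      change (if h : g v = v then -(#{p | g p = v} : ℂ) else 0) + fiberSum g (fun _ => 1) v w = 0
      by_cases hv : g v = v
      · simp [hv, fiberSum]
      · rw [dif_neg hv, zero_add]
        refine Finset.sum_eq_zero fun p hp => ?_
        simp only [mem_filter, mem_univ, true_and] at hp
        exact absurd (hp ▸ hg p) hv
    have hτk : τ k = 0 := by
      rw [← hsum k 1, hΘk]
      simp
    refine (finrank_eq_one_iff_of_nonzero' (⟨⟨k, hτk⟩, hΘk⟩ :
      LinearMap.ker (Θ.domRestrict (LinearMap.ker τ))) ?_).mpr ?_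
    · intro h
      have : k = 0 := congrArg (fun x => x.1.1) h
      have := congrFun (congrArg Prod.snd this) x₀
      simp [k] at this
    · rintro ⟨⟨x, hx⟩, hx'⟩
      have hΘx : ∀ v w, (if h : g v = v then x.1 ⟨v, h⟩ else 0) + fiberSum g x.2 v w = 0 :=
        fun v w => congrFun (congrFun hx' v) w
      have hconst : ∀ a b, x.2 a = x.2 b := by
        intro a b
        by_cases hab : a = b
        · rw [hab]
        obtain ⟨w, rfl, rfl⟩ := exists_perm_two h₀₁ hab
        have := fiberSum_sub_swap g x.2 (p := x₀) (q := x₁) (by rwa [h₀, h₁]) w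
        have e1 := hΘx (g x₀) w
        have e2 := hΘx (g x₀) (w * swap x₀ x₁)
        linear_combination -this + e1 - e2
      refine ⟨x.2 x₀, Subtype.ext (Subtype.ext (Prod.ext ?_ ?_))⟩
      · funext v
        have e := hΘx v.1 1
        rw [dif_pos v.2] at e
        have : fiberSum g x.2 v.1 1 = #{p | g p = v.1} * x.2 x₀ := by
          rw [fiberSum, Finset.sum_congr rfl fun p _ => hconst _ x₀]
          simp
        rw [this] at e
        change x.2 x₀ * -(#{p | g p = v.1} : ℂ) = x.1 v
        linear_combination -e
      · funext a
        change x.2 x₀ * 1 = x.2 a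
        rw [mul_one, hconst]
  have := LinearMap.finrank_range_add_finrank_ker (Θ.domRestrict (LinearMap.ker τ))
  rw [hrange, hk] at this
  omega

end GateSpace

end CayleySplines

namespace CayleySplines

open Equiv Finset

/-! ### Coefficient families and their decomposition along a gate system -/

section EdgeForms

variable {V : Type*} [DecidableEq V]

/-- The coefficient families of linear splines: `Φ v w` is the coefficient of `t_{w(v)}` in the
value of the spline at `w`. -/
def edgeForms (Γ : SimpleGraph V) : Submodule ℂ (V → Perm V → ℂ) where
  carrier := {Φ | ∀ i j, Γ.Adj i j →
    (∀ k, k ≠ i → k ≠ j → SwapInvariant (Φ k) i j) ∧ SwapInvariant (Φ i + Φ j) i j}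
  zero_mem' := fun _ _ _ => ⟨fun _ _ _ _ => rfl, fun _ => rfl⟩
  add_mem' := by
    intro Φ Φ' h h' i j hij
    refine ⟨fun k hi hj => ((h i j hij).1 k hi hj).add ((h' i j hij).1 k hi hj), ?_⟩
    have := (h i j hij).2.add (h' i j hij).2
    rwa [add_add_add_comm] at this
  smul_mem' := by
    intro c Φ h i j hij
    refine ⟨fun k hi hj => ((h i j hij).1 k hi hj).smul c, ?_⟩
    have := (h i j hij).2.smul c
    rwa [smul_add] at this

lemma sum_swapInvariant_of_mem_edgeForms {Γ : SimpleGraph V} {Φ : V → Perm V → ℂ}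
    (hΦ : Φ ∈ edgeForms Γ) {i j : V} (hij : Γ.Adj i j) {s : Finset V} (hs : i ∈ s ↔ j ∈ s) :
    SwapInvariant (∑ k ∈ s, Φ k) i j := by
  by_cases hi : i ∈ s
  · have hsub : {i, j} ⊆ s := by
      intro x hx
      rcases mem_insert.mp hx with rfl | hx
      · exact hi
      · rw [mem_singleton.mp hx]; exact hs.mp hi
    rw [← Finset.sum_sdiff hsub, Finset.sum_pair hij.ne]
    refine (SwapInvariant.sum fun k hk => ?_).add (hΦ i j hij).2
    simp only [mem_sdiff, mem_insert, mem_singleton, not_or] at hk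
    exact (hΦ i j hij).1 k hk.2.1 hk.2.2
  · refine SwapInvariant.sum fun k hk => (hΦ i j hij).1 k ?_ ?_
    · rintro rfl; exact hi hk
    · rintro rfl; exact hi (hs.mpr hk)

lemma swapInvariant_of_reflTransGen {f : Perm V → ℂ} {r : V → V → Prop}
    (h : ∀ i j, r i j → SwapInvariant f i j) {p q : V} (hpq : Relation.ReflTransGen r p q) :
    SwapInvariant f p q := by
  induction hpq with
  | refl => exact SwapInvariant.refl _ _
  | tail _ hr ih => exact ih.trans (h _ _ hr)

variable [Fintype V]

/-- The coefficient families of linear splines whose coefficients sum to zero. -/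
def zeroSumForms (Γ : SimpleGraph V) : Submodule ℂ (V → Perm V → ℂ) where
  carrier := {Φ | Φ ∈ edgeForms Γ ∧ ∑ v, Φ v = 0}
  zero_mem' := ⟨zero_mem _, by simp⟩
  add_mem' := by
    rintro Φ Φ' ⟨h1, h2⟩ ⟨h1', h2'⟩
    exact ⟨add_mem h1 h1', by simp only [Pi.add_apply, sum_add_distrib, h2, h2', add_zero]⟩
  smul_mem' := by
    rintro c Φ ⟨h1, h2⟩
    exact ⟨Submodule.smul_mem _ c h1, by simp only [Pi.smul_apply, ← smul_sum, h2, smul_zero]⟩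

lemma sum_apply_eq_of_mem_edgeForms {Γ : SimpleGraph V} (hΓ : Γ.Connected)
    {Φ : V → Perm V → ℂ} (hΦ : Φ ∈ edgeForms Γ) (w w' : Perm V) :
    (∑ v, Φ v) w = (∑ v, Φ v) w' :=
  apply_eq_apply_of_swapInvariant (fun p q => swapInvariant_of_reflTransGen
    (fun _ _ hij => sum_swapInvariant_of_mem_edgeForms hΦ hij (by simp))
    ((SimpleGraph.reachable_iff_reflTransGen p q).mp (hΓ.preconnected p q))) w w'

lemma finrank_edgeForms {Γ : SimpleGraph V} (hΓ : Γ.Connected) :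
    Module.finrank ℂ (edgeForms Γ) = Module.finrank ℂ (zeroSumForms Γ) + 1 := by
  let f : Module.Dual ℂ (edgeForms Γ) :=
    { toFun := fun Φ => (∑ v, Φ.1 v) 1
      map_add' := fun Φ Φ' => by simp [sum_add_distrib]
      map_smul' := fun c Φ => by simp [mul_sum] }
  obtain ⟨r⟩ := hΓ.nonempty
  -- This is the coefficient family of `x̄ᵣ`, whose coefficients sum to 1.
  have hr : (fun v _ => if v = r then 1 else 0 : V → Perm V → ℂ) ∈ edgeForms Γ :=
    fun i j _ => ⟨fun _ _ _ _ => rfl, fun _ => rfl⟩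
  have hf : f ≠ 0 := by
    intro h
    have : f ⟨_, hr⟩ = 0 := by rw [h]; rfl
    simp [f] at this
  have hmap : (LinearMap.ker f).map (edgeForms Γ).subtype = zeroSumForms Γ := by
    ext Φ
    simp only [Submodule.mem_map, LinearMap.mem_ker, Submodule.subtype_apply]
    constructor
    · rintro ⟨Φ, h, rfl⟩
      refine ⟨Φ.2, funext fun w => ?_⟩
      rw [sum_apply_eq_of_mem_edgeForms hΓ Φ.2 w 1]
      exact h
    · rintro ⟨h1, h2⟩
      exact ⟨⟨Φ, h1⟩, congrFun h2 1, rfl⟩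
  rw [← Module.Dual.finrank_ker_add_one_of_ne_zero hf, ← hmap, Submodule.finrank_map_subtype_eq]

/-- A family of retractions of the vertex set that behaves like the gate maps onto the blocks
of `Γ`. -/
structure IsGateSystem {ι : Type*} (Γ : SimpleGraph V) (g : ι → V → V) : Prop where
  idem : ∀ b v, g b (g b v) = g b v
  edge : ∀ b p q, Γ.Adj p q → g b p = g b q ∨ (g b p = p ∧ g b q = q)
  existsUnique : ∀ i k, k ≠ i → ∃! b, g b i = i ∧ g b k ≠ i
  const : ∀ b b', b ≠ b' → ∀ p q, g b (g b' p) = g b (g b' q)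
  conn : ∀ b v, g b v = v → ∀ p q, (g b p = v ↔ g b q = v) →
    Relation.ReflTransGen (fun i j => Γ.Adj i j ∧ (g b i = v ↔ g b j = v)) p q

variable {ι : Type*} {Γ : SimpleGraph V} {g : ι → V → V}

lemma IsGateSystem.fiber_sum_mem_gateSpace (hg : IsGateSystem Γ g) (b : ι)
    {Φ : V → Perm V → ℂ} (hΦ : Φ ∈ zeroSumForms Γ) :
    (fun v => ∑ k with g b k = v, Φ k) ∈ gateSpace (g b) := by
  have hzero : ∀ v, g b v ≠ v → ∑ k with g b k = v, Φ k = 0 := by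
    intro v hv
    rw [Finset.filter_eq_empty_iff.mpr, Finset.sum_empty]
    rintro k _ rfl
    exact hv (hg.idem b k)
  refine ⟨hzero, fun v p q hpq => ?_, ?_⟩
  · by_cases hv : g b v = v
    · refine swapInvariant_of_reflTransGen (fun i j hij => ?_) (hg.conn b v hv p q hpq)
      exact sum_swapInvariant_of_mem_edgeForms hΦ.1 hij.1 (by simpa using hij.2)
    · intro w
      beta_reduce
      rw [hzero v hv]
      rfl
  · rw [Finset.sum_fiberwise, hΦ.2]

variable [Fintype ι]

/-- An edge either lies in the block, where the zero sum makes `F i + F j` invariant, or has both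
ends in one fibre, where every member is invariant. -/
lemma IsGateSystem.sum_mem_zeroSumForms (hg : IsGateSystem Γ g) {F : ι → V → Perm V → ℂ}
    (hF : ∀ b, F b ∈ gateSpace (g b)) : ∑ b, F b ∈ zeroSumForms Γ := by
  have hinv : ∀ i j, Γ.Adj i j → ∀ b k, (k = i → g b j = i ∨ g b i ≠ i) →
      (k = j → g b i = j ∨ g b j ≠ j) → SwapInvariant (F b k) i j := by
    intro i j hij b k hi hj
    by_cases hk : g b k = k
    · refine (hF b).2.1 k i j ?_
      rcases hg.edge b i j hij with h | ⟨h1, h2⟩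
      · rw [h]
      · by_cases h3 : k = i
        · subst h3; simp [h1, (hi rfl).resolve_right (not_not.mpr h1)]
        · by_cases h4 : k = j
          · subst h4; simp [h2, (hj rfl).resolve_right (not_not.mpr h2)]
          · rw [h1, h2]; simp [Ne.symm h3, Ne.symm h4]
    · intro w
      rw [(hF b).1 k hk]
      rfl
  constructor
  · intro i j hij
    constructor
    · intro k hi hj
      rw [Finset.sum_apply]
      exact SwapInvariant.sum fun b _ => hinv i j hij b k (fun h => absurd h hi)
        (fun h => absurd h hj)
    · rw [Finset.sum_apply, Finset.sum_apply, ← Finset.sum_add_distrib]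
      refine SwapInvariant.sum fun b _ => ?_
      by_cases h : g b i = i ∧ g b j = j
      · exact add_swapInvariant_of_mem_gateSpace (hF b) hij.ne (Or.inl h.1) (Or.inr h.2)
      · have hb := (hg.edge b i j hij).resolve_right h
        refine (hinv i j hij b i (fun _ => ?_) (fun e => absurd e hij.ne)).add
          (hinv i j hij b j (fun e => absurd e hij.ne.symm) (fun _ => ?_))
        · rw [← hb]; exact em _
        · rw [hb]; exact em _
  · simp only [Finset.sum_apply]
    rw [Finset.sum_comm]
    exact Finset.sum_eq_zero fun b _ => (hF b).2.2

/-- Taking fibre sums over each block and adding the block families are mutually inverse. -/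
lemma IsGateSystem.finrank_zeroSumForms (hg : IsGateSystem Γ g) :
    Module.finrank ℂ (zeroSumForms Γ) = ∑ b, Module.finrank ℂ (gateSpace (g b)) := by
  classical
  rw [← Module.finrank_pi_fintype]
  let e : zeroSumForms Γ ≃ₗ[ℂ] (∀ b, gateSpace (g b)) :=
    { toFun := fun Φ b => ⟨fun v => ∑ k with g b k = v, Φ.1 k, hg.fiber_sum_mem_gateSpace b Φ.2⟩
      map_add' := by
        intro Φ Φ'
        funext b
        refine Subtype.ext (funext fun v => ?_)
        exact Finset.sum_add_distrib
      map_smul' := by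
        intro c Φ
        funext b
        refine Subtype.ext (funext fun v => ?_)
        exact (Finset.smul_sum (r := c) (f := Φ.1) (s := {k | g b k = v})).symm
      invFun := fun F => ⟨∑ b, (F b).1, hg.sum_mem_zeroSumForms fun b => (F b).2⟩
      left_inv := by
        rintro ⟨Φ, hΦ⟩
        refine Subtype.ext (funext fun i => ?_)
        change (∑ b, fun v => ∑ k with g b k = v, Φ k) i = Φ i
        rw [Finset.sum_apply]
        -- By the zero sum, a fibre sum is minus the sum over the complement. As `b` runs over the
        -- blocks containing `i`, these complements partition the vertices `k ≠ i`, so the total is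
        -- `-∑ k ≠ i, Φ k = Φ i`.
        have h1 : ∀ b, ∑ k with g b k = i, Φ k
            = if g b i = i then -∑ k with g b k ≠ i, Φ k else 0 := by
          intro b
          split_ifs with h
          · rw [eq_neg_iff_add_eq_zero, Finset.sum_filter_add_sum_filter_not, hΦ.2]
          · rw [Finset.filter_eq_empty_iff.mpr, Finset.sum_empty]
            rintro k _ rfl
            exact h (hg.idem b k)
        have h2 : ∀ b, (if g b i = i then -∑ k with g b k ≠ i, Φ k else 0)
            = -∑ k, if g b i = i ∧ g b k ≠ i then Φ k else 0 := by
          intro b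
          split_ifs with h
          · rw [Finset.sum_filter]; simp [h]
          · simp [h]
        have h3 : ∀ k, ∑ b, (if g b i = i ∧ g b k ≠ i then Φ k else 0)
            = if k = i then 0 else Φ k := by
          intro k
          split_ifs with h
          · subst h
            exact Finset.sum_eq_zero fun b _ => if_neg fun h => h.2 h.1
          · obtain ⟨b, hb, hb'⟩ := hg.existsUnique i k h
            rw [Finset.sum_eq_single b (fun c _ hc => if_neg fun h => hc (hb' c h)) (by simp),
              if_pos hb]
        simp only [h1, h2, Finset.sum_neg_distrib]
        rw [Finset.sum_comm]
        simp only [h3]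
        have h4 := hΦ.2
        rw [← Finset.add_sum_erase _ _ (mem_univ i)] at h4
        rw [eq_neg_of_add_eq_zero_left h4, neg_inj]
        rw [← Finset.add_sum_erase _ _ (mem_univ i), if_pos rfl, zero_add]
        exact Finset.sum_congr rfl fun k hk => if_neg (Finset.ne_of_mem_erase hk)
      right_inv := by
        intro F
        funext b
        refine Subtype.ext (funext fun v => ?_)
        change ∑ k with g b k = v, (∑ c, (F c).1) k = (F b).1 v
        simp only [Finset.sum_apply]
        rw [Finset.sum_comm, Finset.sum_eq_single b _ (by simp)]
        · by_cases hv : g b v = v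
          · refine Finset.sum_eq_single v (fun k hk hkv => ?_) (fun h => ?_)
            · refine (F b).2.1 k fun h => hkv ?_
              simp only [mem_filter, mem_univ, true_and] at hk
              exact h.symm.trans hk
            · simp [hv] at h
          · rw [(F b).2.1 v hv, Finset.filter_eq_empty_iff.mpr, Finset.sum_empty]
            rintro k _ rfl
            exact hv (hg.idem b k)
        · intro c _ hc
          -- The retraction `g b` is constant on the block `c ≠ b`. The fibre sum of `F c` is
          -- therefore its whole sum, which is 0, or has only zero terms.
          by_cases hall : ∀ k, g c k = k → g b k = v
          · rw [← (F c).2.2.2]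
            refine Finset.sum_subset (subset_univ _) fun k _ hk => ?_
            refine (F c).2.1 k fun h => hk ?_
            simpa using hall k h
          · push Not at hall
            obtain ⟨k₀, h0, h0'⟩ := hall
            refine Finset.sum_eq_zero fun k hk => (F c).2.1 k fun h => h0' ?_
            simp only [mem_filter, mem_univ, true_and] at hk
            rw [← hk, ← h0, ← h]
            exact hg.const b c hc.symm k₀ k }
  exact e.finrank_eq

end EdgeForms

end CayleySplines

namespace CayleySplines

/-! ### Walks confined to a set of vertices -/

section WalkIn

variable {V : Type*} {Γ : SimpleGraph V}

/-- `p` and `q` are joined by a walk inside `S`. -/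
def WalkIn (Γ : SimpleGraph V) (S : Set V) (p q : V) : Prop :=
  ∃ W : Γ.Walk p q, ∀ x ∈ W.support, x ∈ S

lemma WalkIn.refl {S : Set V} {p : V} (hp : p ∈ S) : WalkIn Γ S p p :=
  ⟨.nil, by simpa using hp⟩

lemma WalkIn.symm {S : Set V} {p q : V} (h : WalkIn Γ S p q) : WalkIn Γ S q p := by
  obtain ⟨W, hW⟩ := h
  exact ⟨W.reverse, by simpa using hW⟩

lemma WalkIn.trans {S : Set V} {p q r : V} (h : WalkIn Γ S p q) (h' : WalkIn Γ S q r) :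
    WalkIn Γ S p r := by
  obtain ⟨W, hW⟩ := h
  obtain ⟨W', hW'⟩ := h'
  refine ⟨W.append W', fun x hx => ?_⟩
  rcases SimpleGraph.Walk.mem_support_append_iff _ _ |>.mp hx with h | h
  · exact hW x h
  · exact hW' x h

lemma WalkIn.mono {S T : Set V} (hST : S ⊆ T) {p q : V} (h : WalkIn Γ S p q) : WalkIn Γ T p q := by
  obtain ⟨W, hW⟩ := h
  exact ⟨W, fun x hx => hST (hW x hx)⟩

lemma WalkIn.of_adj {S : Set V} {p q : V} (h : Γ.Adj p q) (hp : p ∈ S) (hq : q ∈ S) :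
    WalkIn Γ S p q :=
  ⟨h.toWalk, by simp [hp, hq]⟩

lemma WalkIn.left_mem {S : Set V} {p q : V} (h : WalkIn Γ S p q) : p ∈ S := by
  obtain ⟨W, hW⟩ := h
  exact hW _ W.start_mem_support

lemma WalkIn.right_mem {S : Set V} {p q : V} (h : WalkIn Γ S p q) : q ∈ S :=
  h.symm.left_mem

lemma walkIn_iff_reachable {S : Set V} {p q : V} (hp : p ∈ S) (hq : q ∈ S) :
    WalkIn Γ S p q ↔ (Γ.induce S).Reachable ⟨p, hp⟩ ⟨q, hq⟩ := by
  constructor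
  · rintro ⟨W, hW⟩
    exact ⟨W.induce S hW⟩
  · rintro ⟨W⟩
    have key : ∀ a b : S, (Γ.induce S).Walk a b → WalkIn Γ S a b := by
      intro a b W
      induction W with
      | nil => exact WalkIn.refl (Subtype.property _)
      | cons h _ ih =>
        exact (WalkIn.of_adj (Γ := Γ) h (Subtype.property _) (Subtype.property _)).trans ih
    exact key _ _ W

lemma induce_connected_iff {S : Set V} :
    (Γ.induce S).Connected ↔ ∃ u ∈ S, ∀ q ∈ S, WalkIn Γ S u q := by
  rw [SimpleGraph.connected_iff_exists_forall_reachable]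
  constructor
  · rintro ⟨⟨u, hu⟩, h⟩
    exact ⟨u, hu, fun q hq => (walkIn_iff_reachable hu hq).mpr (h ⟨q, hq⟩)⟩
  · rintro ⟨u, hu, h⟩
    exact ⟨⟨u, hu⟩, fun q => (walkIn_iff_reachable hu q.2).mp (h q.1 q.2)⟩

lemma walkIn_of_connected {S : Set V} (h : (Γ.induce S).Connected) {p q : V} (hp : p ∈ S)
    (hq : q ∈ S) : WalkIn Γ S p q :=
  (walkIn_iff_reachable hp hq).mpr (h.preconnected _ _)

lemma walkIn_takeUntil_or_dropUntil [DecidableEq V] {a b : V} {P : Γ.Walk a b} (hP : P.IsPath)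
    {y : V} (hy : y ∈ P.support) {x : V} (hxy : y ≠ x) :
    WalkIn Γ ({z | z ∈ P.support} \ {x}) a y ∨ WalkIn Γ ({z | z ∈ P.support} \ {x}) y b := by
  by_cases hx : x ∈ (P.takeUntil y hy).support
  · right
    refine ⟨P.dropUntil y hy, fun z hz => ⟨P.support_dropUntil_subset_support hy hz, ?_⟩⟩
    rintro rfl
    have hnd := hP.support_nodup
    rw [← P.take_spec hy, SimpleGraph.Walk.support_append] at hnd
    refine List.disjoint_of_nodup_append hnd hx ?_
    rw [SimpleGraph.Walk.mem_support_iff] at hz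
    exact hz.resolve_left (Ne.symm hxy)
  · left
    refine ⟨P.takeUntil y hy, fun z hz => ⟨P.support_takeUntil_subset_support hy hz, ?_⟩⟩
    rintro rfl
    exact hx hz

end WalkIn

/-! ### Vertex sets inducing 2-connected subgraphs -/

section TwoConnected

variable {V : Type*} {Γ : SimpleGraph V}

/-- `T` induces a `2`-connected subgraph of `Γ`. -/
def TwoConnected (Γ : SimpleGraph V) (T : Set V) : Prop :=
  (Γ.induce T).Connected ∧ ∀ x ∈ T, (Γ.induce (T \ {x})).Connected

lemma TwoConnected.walkIn {T : Set V} (h : TwoConnected Γ T) {x p q : V} (hp : p ∈ T) (hq : q ∈ T)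
    (hpx : p ≠ x) (hqx : q ≠ x) : WalkIn Γ (T \ {x}) p q := by
  by_cases hx : x ∈ T
  · exact walkIn_of_connected (h.2 x hx) ⟨hp, hpx⟩ ⟨hq, hqx⟩
  · exact WalkIn.mono (T := T \ {x}) (fun y hy => ⟨hy, fun e => hx (e ▸ hy)⟩)
      (walkIn_of_connected h.1 hp hq)

lemma TwoConnected.exists_ne {T : Set V} (h : TwoConnected Γ T) (x : V) : ∃ y ∈ T, y ≠ x := by
  by_cases hx : x ∈ T
  · obtain ⟨y, hy, -⟩ := induce_connected_iff.mp (h.2 x hx)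
    exact ⟨y, hy.1, hy.2⟩
  · obtain ⟨y, hy, -⟩ := induce_connected_iff.mp h.1
    exact ⟨y, hy, fun e => hx (e ▸ hy)⟩

lemma TwoConnected.exists_adj {T : Set V} (h : TwoConnected Γ T) {v : V} (hv : v ∈ T) :
    ∃ j ∈ T, Γ.Adj v j := by
  obtain ⟨y, hy, hyv⟩ := h.exists_ne v
  obtain ⟨W, hW⟩ := walkIn_of_connected h.1 hv hy
  cases W with
  | nil => exact absurd rfl hyv
  | cons hadj W' => exact ⟨_, hW _ (by simp), hadj⟩

lemma twoConnected_pair {i j : V} (h : Γ.Adj i j) : TwoConnected Γ {i, j} := by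
  refine ⟨SimpleGraph.induce_pair_connected_of_adj h, fun x hx => induce_connected_iff.mpr ?_⟩
  rcases hx with rfl | rfl
  · refine ⟨j, ⟨by simp, h.ne.symm⟩, ?_⟩
    rintro q ⟨rfl | rfl, hq⟩
    · exact absurd rfl hq
    · exact WalkIn.refl ⟨by simp, hq⟩
  · refine ⟨i, ⟨by simp, h.ne⟩, ?_⟩
    rintro q ⟨rfl | rfl, hq⟩
    · exact WalkIn.refl ⟨by simp, hq⟩
    · exact absurd rfl hq

/-- After deletion of one vertex, at least one of `a`, `b` survives and links the two parts. -/
lemma TwoConnected.union {S T : Set V} (hS : TwoConnected Γ S) (hT : TwoConnected Γ T) {a b : V}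
    (hab : a ≠ b) (haS : a ∈ S) (haT : a ∈ T) (hbS : b ∈ S) (hbT : b ∈ T) :
    TwoConnected Γ (S ∪ T) := by
  constructor
  · exact SimpleGraph.induce_union_connected hS.1.preconnected hT.1.preconnected ⟨a, haS, haT⟩
  · intro x _
    obtain ⟨c, hcS, hcT, hcx⟩ : ∃ c, c ∈ S ∧ c ∈ T ∧ c ≠ x := by
      by_cases h : a = x
      · exact ⟨b, hbS, hbT, fun e => hab (h.trans e.symm)⟩
      · exact ⟨a, haS, haT, h⟩
    refine induce_connected_iff.mpr ⟨c, ⟨Or.inl hcS, hcx⟩, ?_⟩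
    rintro q ⟨hq | hq, hqx⟩
    · exact (hS.walkIn hcS hq hcx hqx).mono (Set.sdiff_subset_sdiff_left Set.subset_union_left)
    · exact (hT.walkIn hcT hq hcx hqx).mono (Set.sdiff_subset_sdiff_left Set.subset_union_right)

/-- Two neighbours of `v` that are joined by a walk avoiding `v` lie on a common cycle with `v`. -/
lemma exists_twoConnected_of_walkIn_compl {v j j' : V} (hj : Γ.Adj v j) (hj' : Γ.Adj v j')
    (h : WalkIn Γ {v}ᶜ j j') : ∃ T, TwoConnected Γ T ∧ v ∈ T ∧ j ∈ T ∧ j' ∈ T := by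
  classical
  obtain ⟨W, hW⟩ := h
  have hP : W.bypass.IsPath := W.bypass_isPath
  have hPv : ∀ x ∈ W.bypass.support, x ≠ v :=
    fun x hx => hW x (W.support_bypass_subset_support hx)
  generalize W.bypass = P at hP hPv
  refine ⟨insert v {z | z ∈ P.support}, ⟨?_, ?_⟩, by simp, by simp, by simp⟩
  · refine induce_connected_iff.mpr ⟨v, by simp, ?_⟩
    rintro q (rfl | hq)
    · exact WalkIn.refl (by simp)
    · refine (WalkIn.of_adj hj (by simp) (by simp)).trans ⟨P.takeUntil q hq, fun z hz => ?_⟩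
      exact Or.inr (P.support_takeUntil_subset_support hq hz)
  · rintro x (rfl | hx)
    · refine induce_connected_iff.mpr ⟨j, ⟨by simp, hj.ne.symm⟩, ?_⟩
      rintro q ⟨rfl | hq, hqx⟩
      · exact absurd rfl hqx
      · refine ⟨P.takeUntil q hq, fun z hz => ?_⟩
        have := P.support_takeUntil_subset_support hq hz
        exact ⟨Or.inr this, hPv z this⟩
    · have hvx : v ≠ x := (hPv x hx).symm
      refine induce_connected_iff.mpr ⟨v, ⟨by simp, hvx⟩, ?_⟩
      have hsub : {z | z ∈ P.support} \ {x} ⊆ insert v {z | z ∈ P.support} \ {x} :=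
        Set.sdiff_subset_sdiff_left (Set.subset_insert _ _)
      have hv : v ∈ insert v {z | z ∈ P.support} \ {x} := ⟨by simp, hvx⟩
      rintro q ⟨rfl | hq, hqx⟩
      · exact WalkIn.refl hv
      · rcases walkIn_takeUntil_or_dropUntil hP hq hqx with h | h
        · exact (WalkIn.of_adj hj hv (hsub h.left_mem)).trans (h.mono hsub)
        · exact (WalkIn.of_adj hj' hv (hsub h.right_mem)).trans (h.mono hsub).symm

end TwoConnected

/-! ### Blocks as vertex sets, and existence of gates -/

section BlockSet

variable {V : Type*} {Γ : SimpleGraph V}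

/-- The vertex sets of the blocks of `Γ`. -/
abbrev BlockSet (Γ : SimpleGraph V) := {T : Set V // Maximal (TwoConnected Γ) T}

lemma BlockSet.twoConnected (B : BlockSet Γ) : TwoConnected Γ B.1 := B.2.prop

lemma exists_blockSet_of_twoConnected [Finite V] {T : Set V} (h : TwoConnected Γ T) :
    ∃ B : BlockSet Γ, T ⊆ B.1 := by
  obtain ⟨B, hB, hmax⟩ := Finite.exists_le_maximal h
  exact ⟨⟨B, hmax⟩, hB⟩

lemma BlockSet.eq_of_two_mem {B B' : BlockSet Γ} {a b : V} (hab : a ≠ b) (ha : a ∈ B.1)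
    (hb : b ∈ B.1) (ha' : a ∈ B'.1) (hb' : b ∈ B'.1) : B = B' := by
  have h := B.twoConnected.union B'.twoConnected hab ha ha' hb hb'
  have h1 := B.2.eq_of_subset h Set.subset_union_left
  have h2 := B'.2.eq_of_subset h Set.subset_union_right
  exact Subtype.ext (h1.trans h2.symm)

/-- A neighbour of `v` in `B` and one in `B'` are joined by a walk avoiding `v`, so both lie with
`v` in a common block. That block shares two vertices with each of `B` and `B'`. -/
lemma BlockSet.eq_of_walkIn [Finite V] {B B' : BlockSet Γ} {v b b' : V} (hv : v ∈ B.1)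
    (hv' : v ∈ B'.1) (hb : b ∈ B.1) (hb' : b' ∈ B'.1) (h : WalkIn Γ {v}ᶜ b b') : B = B' := by
  have hsub : ∀ S : Set V, S \ {v} ⊆ {v}ᶜ := fun S x hx => hx.2
  obtain ⟨j, hj, hvj⟩ := B.twoConnected.exists_adj hv
  obtain ⟨j', hj', hvj'⟩ := B'.twoConnected.exists_adj hv'
  have h1 := (B.twoConnected.walkIn hj hb hvj.ne.symm h.left_mem).mono (hsub _)
  have h2 := (B'.twoConnected.walkIn hb' hj' h.right_mem hvj'.ne.symm).mono (hsub _)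
  obtain ⟨T, hT, hvT, hjT, hjT'⟩ :=
    exists_twoConnected_of_walkIn_compl hvj hvj' ((h1.trans h).trans h2)
  obtain ⟨C, hC⟩ := exists_blockSet_of_twoConnected hT
  rw [BlockSet.eq_of_two_mem hvj.ne hv hj (hC hvT) (hC hjT),
    BlockSet.eq_of_two_mem hvj'.ne hv' hj' (hC hvT) (hC hjT')]

lemma exists_blockSet_of_adj [Finite V] {i j : V} (h : Γ.Adj i j) :
    ∃ B : BlockSet Γ, i ∈ B.1 ∧ j ∈ B.1 := by
  obtain ⟨B, hB⟩ := exists_blockSet_of_twoConnected (twoConnected_pair h)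
  exact ⟨B, hB (by simp), hB (by simp)⟩

/-- `p` can be reached from `B` by a walk avoiding `v`. -/
def BlockSet.Far (B : BlockSet Γ) (v p : V) : Prop := ∃ b ∈ B.1, WalkIn Γ {v}ᶜ b p

lemma BlockSet.Far.ne {B : BlockSet Γ} {v p : V} (h : B.Far v p) : p ≠ v := by
  obtain ⟨b, -, h⟩ := h
  exact h.right_mem

lemma BlockSet.Far.trans {B : BlockSet Γ} {v p q : V} (h : B.Far v p) (hpq : WalkIn Γ {v}ᶜ p q) :
    B.Far v q := by
  obtain ⟨b, hb, h⟩ := h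
  exact ⟨b, hb, h.trans hpq⟩

lemma BlockSet.far_of_mem {B : BlockSet Γ} {v p : V} (hp : p ∈ B.1) (hpv : p ≠ v) : B.Far v p :=
  ⟨p, hp, WalkIn.refl hpv⟩

lemma BlockSet.Far.walkIn {B : BlockSet Γ} {v p q : V} (hp : B.Far v p)
    (hq : B.Far v q) : WalkIn Γ {v}ᶜ p q := by
  obtain ⟨b, hb, h⟩ := hp
  obtain ⟨b', hb', h'⟩ := hq
  exact (h.symm.trans ((B.twoConnected.walkIn hb hb' h.left_mem h'.left_mem).mono
    fun x hx => hx.2)).trans h'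

lemma BlockSet.eq_of_far [Finite V] {B B' : BlockSet Γ} {v p : V} (hv : v ∈ B.1) (hv' : v ∈ B'.1)
    (h : B.Far v p) (h' : B'.Far v p) : B = B' := by
  obtain ⟨b, hb, h⟩ := h
  obtain ⟨b', hb', h'⟩ := h'
  exact BlockSet.eq_of_walkIn hv hv' hb hb' (h.trans h'.symm)

lemma exists_blockSet_far [Finite V] (hΓ : Γ.Connected) {v p : V} (h : p ≠ v) :
    ∃ B : BlockSet Γ, v ∈ B.1 ∧ B.Far v p := by
  obtain ⟨P, hP⟩ := hΓ.exists_isPath v p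
  cases P with
  | nil => exact absurd rfl h
  | @cons _ j _ hadj P' =>
    rw [SimpleGraph.Walk.cons_isPath_iff] at hP
    obtain ⟨B, hvB, hjB⟩ := exists_blockSet_of_adj hadj
    refine ⟨B, hvB, j, hjB, P', ?_⟩
    rintro x hx rfl
    exact hP.2 hx

/-- Existence: follow a walk from `B` to `p`. The gate changes across an edge `xy` only if `x` is
the current gate and `y` is again in `B`, and then `y` becomes the gate. Uniqueness: a path from `v`
to `p` either avoids `u`, or has a tail from `u` that avoids `v`. -/
lemma BlockSet.existsUnique_not_far [Finite V] (hΓ : Γ.Connected) (B : BlockSet Γ) (p : V) :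
    ∃! v, v ∈ B.1 ∧ ¬ B.Far v p := by
  classical
  refine existsUnique_of_exists_of_unique ?_ ?_
  · obtain ⟨b, hb, -⟩ := induce_connected_iff.mp B.twoConnected.1
    have := (SimpleGraph.reachable_iff_reflTransGen b p).mp (hΓ.preconnected b p)
    induction this with
    | refl => exact ⟨b, hb, fun h => h.ne rfl⟩
    | @tail x y _ hxy ih =>
      obtain ⟨v, hv, hx⟩ := ih
      by_cases hy : B.Far v y
      · by_cases hxv : x = v
        · subst hxv
          obtain ⟨C, hvC, hyC⟩ := exists_blockSet_of_adj hxy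
          have hBC := BlockSet.eq_of_far hv hvC hy (BlockSet.far_of_mem hyC hxy.ne.symm)
          exact ⟨y, hBC ▸ hyC, fun h => h.ne rfl⟩
        · exact absurd (hy.trans (WalkIn.of_adj hxy.symm hy.ne hxv)) hx
      · exact ⟨v, hv, hy⟩
  · rintro u v ⟨hu, hup⟩ ⟨hv, hvp⟩
    by_contra huv
    obtain ⟨P, hP⟩ := hΓ.exists_isPath v p
    have hpu : p ≠ u := by
      rintro rfl
      exact hvp (BlockSet.far_of_mem hu huv)
    rcases walkIn_takeUntil_or_dropUntil hP P.end_mem_support (x := u) hpu with h | h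
    · exact hup ⟨v, hv, h.mono fun x hx => hx.2⟩
    · by_cases huP : u ∈ P.support
      · refine hvp ⟨u, hu, P.dropUntil u huP, ?_⟩
        rintro z hz rfl
        have hnd := hP.support_nodup
        rw [← P.take_spec huP, SimpleGraph.Walk.support_append] at hnd
        refine List.disjoint_of_nodup_append hnd (SimpleGraph.Walk.start_mem_support _) ?_
        rw [SimpleGraph.Walk.mem_support_iff] at hz
        exact hz.resolve_left (Ne.symm huv)
      · refine hup ⟨v, hv, P, ?_⟩
        rintro z hz rfl
        exact huP hz

end BlockSet

end CayleySplines

namespace CayleySplines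

open Finset

/-! ### The gate retractions form a gate system -/

section Gate

variable {V : Type*} {Γ : SimpleGraph V}

lemma reflTransGen_of_walkIn {S : Set V} {P : V → Prop}
    (hS : (∀ x ∈ S, P x) ∨ ∀ x ∈ S, ¬ P x) {p q : V} (h : WalkIn Γ S p q) :
    Relation.ReflTransGen (fun i j => Γ.Adj i j ∧ (P i ↔ P j)) p q := by
  obtain ⟨W, hW⟩ := h
  induction W with
  | nil => exact .refl
  | @cons u v _ hadj W' ih =>
    refine .head ⟨hadj, ?_⟩ (ih fun x hx => hW x (by simp [hx]))
    have hu := hW u (by simp)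
    have hv := hW v (by simp)
    rcases hS with h | h
    · simp [h u hu, h v hv]
    · simp [h u hu, h v hv]

/-- On a path from `v` to `p`, the tail from any later vertex avoids `v`, so a far vertex on it
would make `p` far. For `v ∈ B` this is connectedness of the gate fibre over `v`. -/
lemma walkIn_not_far (B : BlockSet Γ) {v : V} (hΓ : Γ.Connected) {p : V} (hp : ¬ B.Far v p) :
    WalkIn Γ {x | ¬ B.Far v x} v p := by
  classical
  obtain ⟨P, hP⟩ := hΓ.exists_isPath v p
  refine ⟨P, fun x hx hfar => hp (hfar.trans ?_)⟩
  refine ⟨P.dropUntil x hx, ?_⟩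
  rintro z hz rfl
  have hnd := hP.support_nodup
  rw [← P.take_spec hx, SimpleGraph.Walk.support_append] at hnd
  refine List.disjoint_of_nodup_append hnd (SimpleGraph.Walk.start_mem_support _) ?_
  rw [SimpleGraph.Walk.mem_support_iff] at hz
  exact hz.resolve_left hfar.ne.symm

lemma walkIn_far (B : BlockSet Γ) {v p q : V} (hp : B.Far v p) (hq : B.Far v q) :
    WalkIn Γ {x | B.Far v x} p q := by
  classical
  obtain ⟨W, hW⟩ := hp.walkIn hq
  refine ⟨W, fun x hx => hp.trans ⟨W.takeUntil x hx, fun z hz => ?_⟩⟩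
  exact hW z (W.support_takeUntil_subset_support hx hz)

noncomputable instance [Finite V] : Fintype (BlockSet Γ) := Fintype.ofFinite _

/-- The gate of `p` in the block `B`: the vertex of `B` through which every walk from `p` to `B`
enters `B`. -/
noncomputable def gate [Finite V] (hΓ : Γ.Connected) (B : BlockSet Γ) (p : V) : V :=
  (B.existsUnique_not_far hΓ p).choose

variable [Finite V] (hΓ : Γ.Connected) (B : BlockSet Γ)

lemma gate_mem (p : V) : gate hΓ B p ∈ B.1 :=
  (B.existsUnique_not_far hΓ p).choose_spec.1.1

lemma not_far_gate (p : V) : ¬ B.Far (gate hΓ B p) p :=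
  (B.existsUnique_not_far hΓ p).choose_spec.1.2

lemma gate_eq_iff {v : V} (hv : v ∈ B.1) {p : V} : gate hΓ B p = v ↔ ¬ B.Far v p := by
  constructor
  · rintro rfl
    exact not_far_gate hΓ B p
  · intro h
    exact ((B.existsUnique_not_far hΓ p).choose_spec.2 v ⟨hv, h⟩).symm

lemma gate_self_iff {v : V} : gate hΓ B v = v ↔ v ∈ B.1 := by
  constructor
  · intro h
    rw [← h]
    exact gate_mem hΓ B v
  · intro h
    rw [gate_eq_iff hΓ B h]
    exact fun h => h.ne rfl

/-- If `p` were not its own gate, the edge from `q` would reach `p` without passing through that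
gate. -/
lemma mem_of_adj_of_gate_ne {p q : V} (h : Γ.Adj p q) (hne : gate hΓ B p ≠ gate hΓ B q) :
    p ∈ B.1 := by
  have hq : B.Far (gate hΓ B p) q := by
    by_contra hq
    exact hne ((gate_eq_iff hΓ B (gate_mem hΓ B p)).mpr hq).symm
  by_contra hp
  refine not_far_gate hΓ B p (hq.trans (WalkIn.of_adj h.symm hq.ne ?_))
  intro e
  exact hp ((gate_self_iff hΓ B).mp (Eq.symm e))

lemma gate_eq_of_walkIn {B' : BlockSet Γ} (hne : B ≠ B') {p q : V} (h : WalkIn Γ B'.1 p q) :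
    gate hΓ B p = gate hΓ B q := by
  obtain ⟨W, hW⟩ := h
  induction W with
  | nil => rfl
  | @cons u v _ hadj W' ih =>
    rw [← ih fun x hx => hW x (by simp [hx])]
    by_contra h
    refine hne (BlockSet.eq_of_two_mem hadj.ne (mem_of_adj_of_gate_ne hΓ B hadj h)
      (mem_of_adj_of_gate_ne hΓ B hadj.symm (Ne.symm h)) (hW u (by simp)) (hW v (by simp)))

/-- For `existsUnique`, the block sought is the one at `i` that leads towards `k`. For `const`, an
edge of `B'` with two different gates in `B` would put both its ends in `B`. -/
lemma isGateSystem_gate : IsGateSystem Γ (gate hΓ) where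
  idem B v := (gate_self_iff hΓ B).mpr (gate_mem hΓ B v)
  edge B p q h := by
    by_cases hne : gate hΓ B p = gate hΓ B q
    · exact Or.inl hne
    · exact Or.inr ⟨(gate_self_iff hΓ B).mpr (mem_of_adj_of_gate_ne hΓ B h hne),
        (gate_self_iff hΓ B).mpr (mem_of_adj_of_gate_ne hΓ B h.symm (Ne.symm hne))⟩
  existsUnique i k hik := by
    obtain ⟨B, hi, hB⟩ := exists_blockSet_far hΓ hik
    have key : ∀ B : BlockSet Γ, i ∈ B.1 → (gate hΓ B k ≠ i ↔ B.Far i k) := by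
      intro B hi
      rw [Ne, gate_eq_iff hΓ B hi, not_not]
    refine ⟨B, ⟨(gate_self_iff hΓ B).mpr hi, (key B hi).mpr hB⟩, ?_⟩
    rintro C ⟨hC, hC'⟩
    have hi' := (gate_self_iff hΓ C).mp hC
    exact BlockSet.eq_of_far hi' hi ((key C hi').mp hC') hB
  const B B' hne p q := gate_eq_of_walkIn hΓ B hne
    (walkIn_of_connected B'.twoConnected.1 (gate_mem hΓ B' p) (gate_mem hΓ B' q))
  conn B v hv p q hpq := by
    have hv' := (gate_self_iff hΓ B).mp hv
    simp only [gate_eq_iff hΓ B hv'] at hpq ⊢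
    by_cases hp : B.Far v p
    · have hq : B.Far v q := by
        by_contra h
        exact hpq.mpr h hp
      exact reflTransGen_of_walkIn (Or.inr fun x hx h => h hx) (walkIn_far B hp hq)
    · exact reflTransGen_of_walkIn (Or.inl fun x hx => hx)
        ((walkIn_not_far B hΓ hp).symm.trans (walkIn_not_far B hΓ (hpq.mp hp)))

end Gate

/-! ### Incidence counts between vertices and blocks -/

section Counting

variable {V : Type*} {Γ : SimpleGraph V}

/-- Remove from each block the gate of `r`. Every vertex other than `r` then remains in exactly one
block, and `r` in none. -/
lemma IsGateSystem.sum_card_add_one [Fintype V] [DecidableEq V] {ι : Type*} [Fintype ι]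
    {g : ι → V → V} (hg : IsGateSystem Γ g) (r : V) :
    ∑ b, #{v | g b v = v} + 1 = Fintype.card V + Fintype.card ι := by
  classical
  have h1 : ∀ b, #{v | g b v = v} = #{v | g b v = v ∧ g b r ≠ v} + 1 := by
    intro b
    have hmem : g b r ∈ ({v | g b v = v} : Finset V) := by simp [hg.idem]
    rw [← Finset.card_erase_add_one hmem]
    congr 2
    ext v
    simp only [mem_erase, mem_filter, mem_univ, true_and]
    tauto
  have h2 : ∑ b, #{v | g b v = v ∧ g b r ≠ v} = #((univ : Finset V).erase r) := by
    simp only [Finset.card_filter]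
    rw [Finset.sum_comm, Finset.card_eq_sum_ones, ← Finset.add_sum_erase _ _ (mem_univ r)]
    have : ∑ b, (if g b r = r ∧ g b r ≠ r then 1 else 0) = 0 :=
      Finset.sum_eq_zero fun b _ => if_neg fun h => h.2 h.1
    rw [this, zero_add]
    refine Finset.sum_congr rfl fun v hv => ?_
    obtain ⟨b, hb, hb'⟩ := hg.existsUnique v r (Finset.ne_of_mem_erase hv).symm
    rw [Finset.sum_eq_single b (fun c _ hc => if_neg fun h => hc (hb' c h)) (by simp), if_pos hb]
  have h3 := Finset.card_erase_add_one (mem_univ r)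
  simp only [h1, Finset.sum_add_distrib, h2, Finset.sum_const, smul_eq_mul, mul_one]
  rw [Finset.card_univ] at h3 ⊢
  omega

/-- Each component of `Γ - j` is reached from `j` through exactly one block containing `j`. -/
lemma card_connectedComponent_compl_singleton [Finite V] (hΓ : Γ.Connected) (j : V) :
    Nat.card (Γ.induce {j}ᶜ).ConnectedComponent = Nat.card {B : BlockSet Γ // j ∈ B.1} := by
  let f : ({j}ᶜ : Set V) → {B : BlockSet Γ // j ∈ B.1} := fun p =>
    ⟨(exists_blockSet_far hΓ p.2).choose, (exists_blockSet_far hΓ p.2).choose_spec.1⟩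
  have hf : ∀ p, (f p).1.Far j p.1 := fun p => (exists_blockSet_far hΓ p.2).choose_spec.2
  have hlift : ∀ p q (W : (Γ.induce {j}ᶜ).Walk p q), W.IsPath → f p = f q := by
    intro p q W _
    refine Subtype.ext (BlockSet.eq_of_far (f p).2 (f q).2 (hf p) ((hf q).trans ?_))
    exact (walkIn_iff_reachable q.2 p.2).mpr ⟨W.reverse⟩
  refine Nat.card_eq_of_bijective (SimpleGraph.ConnectedComponent.lift f hlift) ⟨?_, ?_⟩
  · intro C C'
    induction C using SimpleGraph.ConnectedComponent.ind
    induction C' using SimpleGraph.ConnectedComponent.ind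
    rename_i p q
    intro h
    have h' : f p = f q := h
    refine SimpleGraph.ConnectedComponent.sound ((walkIn_iff_reachable p.2 q.2).mp ?_)
    exact (hf p).walkIn (h' ▸ hf q)
  · rintro ⟨B, hB⟩
    obtain ⟨b, hb, hbj⟩ := B.twoConnected.exists_ne j
    refine ⟨(Γ.induce {j}ᶜ).connectedComponentMk ⟨b, hbj⟩, ?_⟩
    exact Subtype.ext (BlockSet.eq_of_far (f ⟨b, hbj⟩).2 hB (hf ⟨b, hbj⟩)
      (BlockSet.far_of_mem hb hbj))

end Counting

end CayleySplines

namespace CayleySplines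

open Equiv Finset MvPolynomial

/-! ### Linear forms divisible by a difference of variables -/

section LinearForms

variable {σ : Type*}

lemma IsHomogeneous.ext_coeff_single {p q : MvPolynomial σ ℂ} (hp : p.IsHomogeneous 1)
    (hq : q.IsHomogeneous 1)
    (h : ∀ i, coeff (Finsupp.single i 1) p = coeff (Finsupp.single i 1) q) : p = q := by
  ext m
  by_cases hm : m.degree = 1
  · obtain ⟨i, rfl⟩ := (Finsupp.sum_eq_one_iff m).mp hm
    exact h i
  · rw [hp.coeff_eq_zero hm, hq.coeff_eq_zero hm]

lemma coeff_single_mul_X [DecidableEq σ] (p : MvPolynomial σ ℂ) (a c : σ) :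
    coeff (Finsupp.single c 1) (p * X a) = if a = c then constantCoeff p else 0 := by
  rw [coeff_mul_X']
  by_cases h : a = c
  · subst h
    simp [constantCoeff_eq]
  · simp [h]

lemma mem_span_X_sub_X_iff [DecidableEq σ] {q : MvPolynomial σ ℂ} (hq : q.IsHomogeneous 1)
    {a b : σ} (hab : a ≠ b) :
    q ∈ Ideal.span {(X a - X b : MvPolynomial σ ℂ)} ↔
      (∀ c, c ≠ a → c ≠ b → coeff (Finsupp.single c 1) q = 0) ∧
        coeff (Finsupp.single a 1) q + coeff (Finsupp.single b 1) q = 0 := by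
  rw [Ideal.mem_span_singleton']
  constructor
  · rintro ⟨p, rfl⟩
    constructor
    · intro c ha hb
      rw [mul_sub, coeff_sub, coeff_single_mul_X, coeff_single_mul_X, if_neg ha.symm,
        if_neg hb.symm, sub_zero]
    · rw [mul_sub, coeff_sub, coeff_sub, coeff_single_mul_X, coeff_single_mul_X,
        coeff_single_mul_X, coeff_single_mul_X]
      simp [hab, hab.symm]
  · rintro ⟨h1, h2⟩
    refine ⟨C (coeff (Finsupp.single a 1) q), IsHomogeneous.ext_coeff_single ?_ hq fun c => ?_⟩
    · have := (isHomogeneous_C σ (coeff (Finsupp.single a 1) q)).mul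
        ((isHomogeneous_X ℂ a).sub (isHomogeneous_X ℂ b))
      simpa using this
    · rw [mul_sub, coeff_sub, coeff_single_mul_X, coeff_single_mul_X, constantCoeff_C]
      by_cases ha : a = c
      · subst ha; simp [hab.symm]
      by_cases hb : b = c
      · subst hb; simp [ha]; linear_combination -h2
      · rw [if_neg ha, if_neg hb, h1 c (Ne.symm ha) (Ne.symm hb), sub_zero]

end LinearForms

/-! ### Linear splines as coefficient families, and the quotients in degree one -/

section SplineForms

variable {n : ℕ} {Γ : SimpleGraph (Fin n)}

/-- The family of polynomials with coefficients `Φ v w` of `t_{w(v)}`. -/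
noncomputable def formValue (Φ : Fin n → Perm (Fin n) → ℂ) (w : Perm (Fin n)) :
    MvPolynomial (Fin n) ℂ :=
  ∑ v, C (Φ v w) * X (w v)

lemma formValue_isHomogeneous (Φ : Fin n → Perm (Fin n) → ℂ) (w : Perm (Fin n)) :
    (formValue Φ w).IsHomogeneous 1 := by
  refine IsHomogeneous.sum _ _ _ fun v _ => ?_
  simpa using (isHomogeneous_C (Fin n) (Φ v w)).mul (isHomogeneous_X ℂ (w v))

lemma coeff_formValue (Φ : Fin n → Perm (Fin n) → ℂ) (w : Perm (Fin n)) (v : Fin n) :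
    coeff (Finsupp.single (w v) 1) (formValue Φ w) = Φ v w := by
  rw [formValue, coeff_sum]
  simp

/-- Passing from `w` to `w * swap i j` changes which variable sits at positions `i` and `j` only.
Divisibility by `t_{w(i)} - t_{w(j)}` thus compares the other coefficients position by position, and
these two through their sum. -/
lemma mem_splines_iff_of_isHomogeneous {ρ : Perm (Fin n) → MvPolynomial (Fin n) ℂ}
    (hρ : ∀ w, (ρ w).IsHomogeneous 1) :
    ρ ∈ splines Γ ↔ (fun v w => coeff (Finsupp.single (w v) 1) (ρ w)) ∈ edgeForms Γ := by
  have key : ∀ w i j, i ≠ j →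
      (ρ w - ρ (w * swap i j) ∈
          Ideal.span {(X (w i) - X (w j) : MvPolynomial (Fin n) ℂ)} ↔
        (∀ k, k ≠ i → k ≠ j → coeff (Finsupp.single ((w * swap i j) k) 1) (ρ (w * swap i j)) =
          coeff (Finsupp.single (w k) 1) (ρ w)) ∧
        coeff (Finsupp.single ((w * swap i j) i) 1) (ρ (w * swap i j)) +
          coeff (Finsupp.single ((w * swap i j) j) 1) (ρ (w * swap i j)) =
        coeff (Finsupp.single (w i) 1) (ρ w) + coeff (Finsupp.single (w j) 1) (ρ w)) := by
    intro w i j hij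
    rw [mem_span_X_sub_X_iff ((hρ _).sub (hρ _)) (fun e => hij (w.injective e))]
    simp only [coeff_sub, Perm.mul_apply, swap_apply_left, swap_apply_right]
    constructor
    · rintro ⟨h1, h2⟩
      refine ⟨fun k hi hj => ?_, by linear_combination -h2⟩
      rw [swap_apply_of_ne_of_ne hi hj]
      have := h1 (w k) (fun e => hi (w.injective e)) (fun e => hj (w.injective e))
      linear_combination -this
    · rintro ⟨h1, h2⟩
      refine ⟨fun c hi hj => ?_, by linear_combination -h2⟩
      obtain ⟨k, rfl⟩ := w.surjective c
      have hi' : k ≠ i := fun e => hi (e ▸ rfl)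
      have hj' : k ≠ j := fun e => hj (e ▸ rfl)
      have := h1 k hi' hj'
      rw [swap_apply_of_ne_of_ne hi' hj'] at this
      linear_combination -this
  constructor
  · intro h i j hij
    exact ⟨fun k hi hj w => ((key w i j hij.ne).mp (h w i j hij)).1 k hi hj,
      fun w => ((key w i j hij.ne).mp (h w i j hij)).2⟩
  · intro h w i j hij
    exact (key w i j hij.ne).mpr ⟨fun k hi hj => (h i j hij).1 k hi hj w, (h i j hij).2 w⟩

/-- Linear splines are determined by their coefficient families. -/
noncomputable def splinesDegOneEquiv (Γ : SimpleGraph (Fin n)) :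
    splinesDeg Γ 1 ≃ₗ[ℂ] edgeForms Γ where
  toFun ρ := ⟨fun v w => coeff (Finsupp.single (w v) 1) (ρ.1.1 w),
    (mem_splines_iff_of_isHomogeneous ρ.2).mp ρ.1.2⟩
  map_add' ρ ρ' := by
    refine Subtype.ext (funext fun v => funext fun w => ?_)
    exact coeff_add _ _ _
  map_smul' c ρ := by
    refine Subtype.ext (funext fun v => funext fun w => ?_)
    exact coeff_smul _ _ _
  invFun Φ := ⟨⟨formValue Φ.1, (mem_splines_iff_of_isHomogeneous (formValue_isHomogeneous Φ.1)).mpr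
    (by simpa only [coeff_formValue] using Φ.2)⟩, formValue_isHomogeneous Φ.1⟩
  left_inv ρ := by
    refine Subtype.ext (Subtype.ext (funext fun w => ?_))
    refine IsHomogeneous.ext_coeff_single (formValue_isHomogeneous _ w) (ρ.2 w) fun i => ?_
    obtain ⟨v, rfl⟩ := w.surjective i
    exact coeff_formValue _ w v
  right_inv Φ := by
    refine Subtype.ext (funext fun v => funext fun w => ?_)
    exact coeff_formValue _ w v

instance finite_splinesDeg_one (Γ : SimpleGraph (Fin n)) : Module.Finite ℂ (splinesDeg Γ 1) :=
  Module.Finite.equiv (splinesDegOneEquiv Γ).symm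

lemma constantCoeff_spline_eq (hΓ : Γ.Connected) (ρ : splines Γ) (w w' : Perm (Fin n)) :
    constantCoeff (ρ.1 w) = constantCoeff (ρ.1 w') := by
  refine apply_eq_apply_of_swapInvariant (f := fun w => constantCoeff (ρ.1 w))
    (fun p q => swapInvariant_of_reflTransGen (r := Γ.Adj) (fun i j hij w => ?_)
      ((SimpleGraph.reachable_iff_reflTransGen p q).mp (hΓ.preconnected p q))) w w'
  obtain ⟨c, hc⟩ := Ideal.mem_span_singleton'.mp (ρ.2 w i j hij)
  have := congrArg constantCoeff hc
  simp only [map_mul, map_sub, constantCoeff_X, sub_zero, mul_zero] at this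
  linear_combination this

/-- The degree-one piece of the quotient of the ring of splines by the ideal generated by `n`
splines, each of whose values is a permutation of the variables. -/
lemma finrank_map_mk_splinesDeg_one (hΓ : Γ.Connected) (y : Fin n → splines Γ)
    (τ : Perm (Fin n) → Perm (Fin n)) (hy : ∀ i w, (y i).1 w = X (τ w i)) :
    Module.Finite ℂ ((splinesDeg Γ 1).map
      (Ideal.Quotient.mkₐ ℂ (Ideal.span (Set.range y))).toLinearMap) ∧
    Module.finrank ℂ ((splinesDeg Γ 1).map
      (Ideal.Quotient.mkₐ ℂ (Ideal.span (Set.range y))).toLinearMap) + n =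
        Module.finrank ℂ (splinesDeg Γ 1) := by
  refine ⟨inferInstance, ?_⟩
  let f := (Ideal.Quotient.mkₐ ℂ (Ideal.span (Set.range y))).toLinearMap.domRestrict
    (splinesDeg Γ 1)
  let L : (Fin n → ℂ) →ₗ[ℂ] splinesDeg Γ 1 := Fintype.linearCombination ℂ
    (fun i => ⟨y i, fun w => by rw [hy]; exact isHomogeneous_X ℂ _⟩ : Fin n → splinesDeg Γ 1)
  have hL : ∀ a w, (L a).1.1 w = ∑ i, C (a i) * X (τ w i) := by
    intro a w
    simp only [L, Fintype.linearCombination_apply]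
    simp [hy, smul_eq_C_mul]
  have hLcoeff : ∀ a w k, coeff (Finsupp.single (τ w k) 1) ((L a).1.1 w) = a k := by
    intro a w k
    rw [hL, coeff_sum]
    simp
  have hinj : Function.Injective L := by
    intro a a' h
    funext k
    rw [← hLcoeff a 1 k, h, hLcoeff]
  -- In degree one, only the constant terms of the multipliers of the generators matter. These do
  -- not depend on `w`, so they give a genuine `ℂ`-linear combination.
  have hker : LinearMap.ker f = LinearMap.range L := by
    ext ρ
    rw [LinearMap.mem_ker, LinearMap.mem_range]
    change Ideal.Quotient.mk _ ρ.1 = 0 ↔ _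
    rw [Ideal.Quotient.eq_zero_iff_mem, Ideal.mem_span_range_iff_exists_fun]
    constructor
    · rintro ⟨c, hc⟩
      refine ⟨fun i => constantCoeff ((c i).1 1), Subtype.ext (Subtype.ext (funext fun w => ?_))⟩
      refine IsHomogeneous.ext_coeff_single ((L _).2 w) (ρ.2 w) fun k => ?_
      obtain ⟨k, rfl⟩ := (τ w).surjective k
      rw [hLcoeff, ← hc]
      simp only [AddSubmonoidClass.coe_finsetSum, MulMemClass.coe_mul, Finset.sum_apply,
        Pi.mul_apply, hy, coeff_sum, coeff_single_mul_X]
      simp [constantCoeff_spline_eq hΓ (c k) 1 w]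
    · rintro ⟨a, rfl⟩
      refine ⟨fun i => algebraMap ℂ _ (a i), ?_⟩
      simp only [L, Fintype.linearCombination_apply]
      simp [Algebra.smul_def]
  have h1 := LinearMap.finrank_range_add_finrank_ker (K := ℂ) (V := splinesDeg Γ 1) f
  rw [hker, LinearMap.finrank_range_of_inj hinj, LinearMap.range_domRestrict] at h1
  simpa using h1

end SplineForms

end CayleySplines

namespace CayleySplines

open Finset

/-! ### Blocks as subgraphs versus blocks as vertex sets -/

section BlockSubgraph

variable {V : Type*} {Γ : SimpleGraph V}

lemma IsKConnected.twoConnected {H : Γ.Subgraph} (h : IsKConnected H.coe 2) :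
    TwoConnected Γ H.verts := by
  have key : ∀ (A : Set H.verts) (S : Set V), A.encard < (2 : ℕ) →
      (∀ x : H.verts, x ∉ A ↔ x.1 ∈ S) → S ⊆ H.verts → (Γ.induce S).Connected := by
    intro A S hA hS hSH
    let f : H.coe.induce Aᶜ →g Γ.induce S :=
      ⟨fun x => ⟨x.1.1, (hS x.1).mp x.2⟩, fun {a b} hab => H.adj_sub hab⟩
    refine (h A hA).map f fun x => ⟨⟨⟨x.1, hSH x.2⟩, (hS ⟨x.1, hSH x.2⟩).mpr x.2⟩, rfl⟩
  constructor
  · exact key ∅ _ (by simp) (by simp) subset_rfl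
  · intro x hx
    refine key {⟨x, hx⟩} _ (by simp) (fun y => ?_) Set.sdiff_subset
    simp [Subtype.ext_iff]

/-- A deleted set with fewer than two elements is empty or a singleton, the two cases of
`TwoConnected`. -/
lemma TwoConnected.isKConnected {T : Set V} (h : TwoConnected Γ T) :
    IsKConnected ((⊤ : Γ.Subgraph).induce T).coe 2 := by
  intro A hA
  have key : ∀ S : Set V, (∀ x : ((⊤ : Γ.Subgraph).induce T).verts, x ∉ A ↔ x.1 ∈ S) → S ⊆ T →
      (Γ.induce S).Connected → ((((⊤ : Γ.Subgraph).induce T).coe).induce Aᶜ).Connected := by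
    intro S hS hST hconn
    let f : Γ.induce S →g (((⊤ : Γ.Subgraph).induce T).coe).induce Aᶜ :=
      ⟨fun x => ⟨⟨x.1, hST x.2⟩, (hS ⟨x.1, hST x.2⟩).mpr x.2⟩,
        fun {a b} hab => ⟨hST a.2, hST b.2, hab⟩⟩
    exact hconn.map f fun x => ⟨⟨x.1.1, (hS x.1).mp x.2⟩, rfl⟩
  have hA' : A.encard ≤ 1 := by
    have h2 : A.encard < 1 + 1 := by
      refine hA.trans_le ?_
      norm_num
    exact Order.le_of_lt_add_one h2
  rcases Set.encard_le_one_iff_eq.mp hA' with rfl | ⟨x, rfl⟩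
  · exact key T (by simp) subset_rfl h.1
  · refine key (T \ {x.1}) (fun y => ?_) Set.sdiff_subset (h.2 x.1 x.2)
    have hy : y.1 ∈ T := y.2
    simp [Subtype.ext_iff, hy]

lemma subgraph_le_top_induce_verts (H : Γ.Subgraph) {T : Set V} (h : H.verts ⊆ T) :
    H ≤ (⊤ : Γ.Subgraph).induce T :=
  ⟨h, fun _ _ hab => ⟨h hab.fst_mem, h hab.snd_mem, H.adj_sub hab⟩⟩

/-- The block with vertex set `B`. -/
def BlockSet.toSubgraph (B : BlockSet Γ) : Γ.Subgraph := (⊤ : Γ.Subgraph).induce B.1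

lemma BlockSet.verts_toSubgraph (B : BlockSet Γ) : B.toSubgraph.verts = B.1 := rfl

lemma BlockSet.toSubgraph_injective :
    Function.Injective (BlockSet.toSubgraph : BlockSet Γ → Γ.Subgraph) :=
  fun _ _ h => Subtype.ext (congrArg SimpleGraph.Subgraph.verts h)

lemma BlockSet.isBlock (B : BlockSet Γ) : IsBlock Γ B.toSubgraph := by
  refine ⟨B.twoConnected.isKConnected, fun H hH hle => ?_⟩
  exact subgraph_le_top_induce_verts H (B.2.le_of_ge hH.twoConnected hle.1)

lemma exists_toSubgraph_eq {H : Γ.Subgraph} (h : IsBlock Γ H) :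
    ∃ B : BlockSet Γ, B.toSubgraph = H := by
  have hT := IsKConnected.twoConnected h.prop
  refine ⟨⟨H.verts, hT, fun T hT' hle => ?_⟩, ?_⟩
  · exact (h.le_of_ge hT'.isKConnected (subgraph_le_top_induce_verts H hle)).1
  · exact (h.eq_of_le hT.isKConnected (subgraph_le_top_induce_verts H subset_rfl)).symm

/-- `B` contains exactly one cut vertex. -/
def BlockSet.IsLeaf (B : BlockSet Γ) : Prop := {v | v ∈ B.1 ∧ IsCutVertex Γ v}.ncard = 1

lemma BlockSet.toSubgraph_mem_leafBlocks_iff (B : BlockSet Γ) :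
    B.toSubgraph ∈ leafBlocks Γ ↔ B.IsLeaf := by
  have key : (blockCutTree Γ).neighborSet (Sum.inr ⟨B.toSubgraph, B.isBlock⟩) =
      Sum.inl '' {v : {v : V // IsCutVertex Γ v} | v.1 ∈ B.1} := by
    ext x
    rw [SimpleGraph.mem_neighborSet, blockCutTree, SimpleGraph.fromRel_adj]
    rcases x with v | C
    · simp [BlockSet.verts_toSubgraph]
    · simp
  have h2 : {v | v ∈ B.1 ∧ IsCutVertex Γ v} =
      Subtype.val '' {v : {v : V // IsCutVertex Γ v} | v.1 ∈ B.1} := by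
    ext v
    simp [and_comm]
  have h3 : ((blockCutTree Γ).neighborSet (Sum.inr ⟨B.toSubgraph, B.isBlock⟩)).ncard =
      {v | v ∈ B.1 ∧ IsCutVertex Γ v}.ncard := by
    rw [key, h2, Set.ncard_image_of_injective _ Sum.inl_injective,
      Set.ncard_image_of_injective _ Subtype.val_injective]
  constructor
  · rintro ⟨_, h⟩
    exact h3.symm.trans h
  · intro h
    exact ⟨B.isBlock, h3.trans h⟩

lemma leafBlocks_eq_image :
    leafBlocks Γ = BlockSet.toSubgraph '' {B : BlockSet Γ | B.IsLeaf} := by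
  ext H
  constructor
  · intro h
    obtain ⟨B, rfl⟩ := exists_toSubgraph_eq h.choose
    exact ⟨B, B.toSubgraph_mem_leafBlocks_iff.mp h, rfl⟩
  · rintro ⟨B, hB, rfl⟩
    exact B.toSubgraph_mem_leafBlocks_iff.mpr hB

lemma internalBlocks_eq_image :
    internalBlocks Γ = BlockSet.toSubgraph '' {B : BlockSet Γ | ¬ B.IsLeaf} := by
  ext H
  constructor
  · rintro ⟨h, hl⟩
    obtain ⟨B, rfl⟩ := exists_toSubgraph_eq h
    exact ⟨B, fun hB => hl (B.toSubgraph_mem_leafBlocks_iff.mpr hB), rfl⟩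
  · rintro ⟨B, hB, rfl⟩
    exact ⟨B.isBlock, fun h => hB (B.toSubgraph_mem_leafBlocks_iff.mp h)⟩

lemma mem_internalCutEdges_iff {s : Sym2 V} :
    s ∈ internalCutEdges Γ ↔
      s ∈ Γ.edgeSet ∧ ∃ B : BlockSet Γ, ¬ B.IsLeaf ∧ B.1 = {v | v ∈ s} := by
  rw [internalCutEdges, internalBlocks_eq_image]
  simp [BlockSet.verts_toSubgraph]

lemma BlockSet.two_le_ncard [Finite V] (B : BlockSet Γ) : 2 ≤ B.1.ncard := by
  obtain ⟨i, hi, -⟩ := induce_connected_iff.mp B.twoConnected.1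
  obtain ⟨j, hj, hij⟩ := B.twoConnected.exists_ne i
  exact (Set.one_lt_ncard (Set.toFinite _)).mpr ⟨i, hi, j, hj, hij.symm⟩

end BlockSubgraph

/-! ### The contribution of each block -/

section BlockDimension

variable {V : Type*} {Γ : SimpleGraph V} [Fintype V] [DecidableEq V] (hΓ : Γ.Connected)

lemma card_gate_fixed (B : BlockSet Γ) : #{v | gate hΓ B v = v} = B.1.ncard := by
  classical
  rw [Set.ncard_eq_toFinset_card' B.1]
  congr 1
  ext v
  simp [gate_self_iff hΓ B]

lemma finrank_gateSpace_gate_of_two_lt (B : BlockSet Γ) (hB : 2 < B.1.ncard) :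
    Module.finrank ℂ (gateSpace (gate hΓ B)) + 2 = Fintype.card V + B.1.ncard := by
  rw [finrank_gateSpace_of_three_le ((isGateSystem_gate hΓ).idem B), card_gate_fixed]
  rw [card_gate_fixed]
  exact hB

lemma finrank_gateSpace_gate_of_eq_pair (B : BlockSet Γ) {i j : V} (hij : i ≠ j)
    (hB : B.1 = {i, j}) : Module.finrank ℂ (gateSpace (gate hΓ B)) =
      (Fintype.card V).choose #{v | gate hΓ B v = i} := by
  refine finrank_gateSpace_of_two hij ?_ ?_ fun v => ?_
  · rw [gate_self_iff, hB]; simp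
  · rw [gate_self_iff, hB]; simp
  · have := gate_mem hΓ B v
    rw [hB] at this
    exact this

/-- One end of the edge is not a cut vertex, so the fibre over it is a singleton and the binomial
coefficient is `n.choose 1`. -/
lemma finrank_gateSpace_gate_of_isLeaf (B : BlockSet Γ) (hB : B.1.ncard = 2) (hleaf : B.IsLeaf) :
    Module.finrank ℂ (gateSpace (gate hΓ B)) = Fintype.card V := by
  obtain ⟨i, j, hij, hBij, hj⟩ : ∃ i j, i ≠ j ∧ B.1 = {i, j} ∧ ¬ IsCutVertex Γ i := by
    obtain ⟨i, j, hij, h⟩ := Set.ncard_eq_two.mp hB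
    by_cases hi : IsCutVertex Γ i
    · refine ⟨j, i, hij.symm, by rw [h, Set.pair_comm], fun hj => ?_⟩
      have : {v | v ∈ B.1 ∧ IsCutVertex Γ v} = B.1 := by
        ext v
        simp only [Set.mem_ofPred_eq, h, Set.mem_insert_iff, Set.mem_singleton_iff,
          and_iff_left_iff_imp]
        rintro (rfl | rfl) <;> assumption
      rw [BlockSet.IsLeaf, this, hB] at hleaf
      exact absurd hleaf (by norm_num)
    · exact ⟨i, j, hij, h, hi⟩
  have hiB : i ∈ B.1 := by simp [hBij]
  have hjB : j ∈ B.1 := by simp [hBij]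
  rw [finrank_gateSpace_gate_of_eq_pair hΓ B hij hBij]
  have : ({v | gate hΓ B v = i} : Finset V) = {i} := by
    ext v
    simp only [mem_filter, mem_univ, true_and, mem_singleton, gate_eq_iff hΓ B hiB]
    constructor
    · intro h
      by_contra hv
      exact h ⟨j, hjB, walkIn_of_connected (not_not.mp hj) hij.symm hv⟩
    · rintro rfl h
      exact h.ne rfl
  rw [this, card_singleton, Nat.choose_one_right]

/-- The components left after deleting the edge are the two gate fibres. Either one may be used,
because the two ends play symmetric roles in the dimension formula. -/
lemma finrank_gateSpace_gate_eq_choose (B : BlockSet Γ) {s : Sym2 V} (hs : s ∈ Γ.edgeSet)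
    (hB : B.1 = {v | v ∈ s}) (C : (Γ.deleteEdges {s}).ConnectedComponent) :
    Module.finrank ℂ (gateSpace (gate hΓ B)) = (Fintype.card V).choose C.supp.ncard := by
  classical
  induction s using Sym2.ind with
  | _ i j =>
  have hij : i ≠ j := SimpleGraph.Adj.ne (G := Γ) hs
  have hB' : B.1 = {i, j} := by
    rw [hB]
    ext v
    simp
  have hi : gate hΓ B i = i := by rw [gate_self_iff, hB']; simp
  have hj : gate hΓ B j = j := by rw [gate_self_iff, hB']; simp
  induction C using SimpleGraph.ConnectedComponent.ind with
  | _ p =>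
  have hsupp : ((Γ.deleteEdges {s(i, j)}).connectedComponentMk p).supp =
      {q | gate hΓ B q = gate hΓ B p} := by
    ext q
    rw [SimpleGraph.ConnectedComponent.mem_supp_iff, SimpleGraph.ConnectedComponent.eq,
      SimpleGraph.reachable_iff_reflTransGen, Set.mem_ofPred_eq]
    constructor
    · intro h
      induction h using Relation.ReflTransGen.head_induction_on with
      | refl => rfl
      | @head a c hac _ ih =>
        rw [SimpleGraph.deleteEdges_adj] at hac
        rw [← ih]
        by_contra hne
        have ha := mem_of_adj_of_gate_ne hΓ B hac.1 hne
        have hc := mem_of_adj_of_gate_ne hΓ B hac.1.symm (Ne.symm hne)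
        have hne' := hac.1.ne
        apply hac.2
        rw [hB'] at ha hc
        simp only [Set.mem_insert_iff, Set.mem_singleton_iff] at ha hc
        rcases ha with rfl | rfl <;> rcases hc with rfl | rfl
        · exact absurd rfl hne'
        · simp
        · simp [Sym2.eq_swap]
        · exact absurd rfl hne'
    · intro h
      have hk := (isGateSystem_gate hΓ).idem B p
      refine Relation.ReflTransGen.mono ?_ _ _
        ((isGateSystem_gate hΓ).conn B _ hk q p (by simp [h]))
      rintro a c ⟨hac, hiff⟩
      rw [SimpleGraph.deleteEdges_adj]
      refine ⟨hac, fun e => ?_⟩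
      have hkB := gate_mem hΓ B p
      rw [hB'] at hkB
      rw [Set.mem_singleton_iff, Sym2.eq_iff] at e
      rcases hkB with hkB | hkB <;> rw [hkB] at hiff <;>
        rcases e with ⟨rfl, rfl⟩ | ⟨rfl, rfl⟩ <;> simp [hi, hj, hij, hij.symm] at hiff
  have hcard : ∀ k, {q | gate hΓ B q = k}.ncard = #{q | gate hΓ B q = k} := by
    intro k
    rw [← Set.ncard_coe_finset]
    congr 1
    ext q
    simp
  rw [hsupp, hcard]
  have hkB := gate_mem hΓ B p
  rw [hB'] at hkB
  rcases hkB with hkB | hkB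
  · rw [hkB]
    exact finrank_gateSpace_gate_of_eq_pair hΓ B hij hB'
  · rw [hkB]
    exact finrank_gateSpace_gate_of_eq_pair hΓ B hij.symm (by rw [hB', Set.pair_comm])

end BlockDimension

end CayleySplines

namespace CayleySplines

open Finset

/-! ### Assembling the dimension formula -/

section Dimension

variable {n : ℕ} {Γ : SimpleGraph (Fin n)}

lemma sum_cutNumber (hΓ : Γ.Connected) [DecidablePred (IsCutVertex Γ)] :
    ∑ j : Fin n with IsCutVertex Γ j, cutNumber Γ j = ∑ B : BlockSet Γ, (B.1.ncard : ℤ) - n := by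
  classical
  -- A vertex that is not a cut vertex leaves one component, so its term is 0 and the sum may run
  -- over all vertices.
  have h1 : ∑ j : Fin n with IsCutVertex Γ j, cutNumber Γ j = ∑ j : Fin n, cutNumber Γ j := by
    refine Finset.sum_subset (subset_univ _) fun j _ hj => ?_
    have hconn : (Γ.induce {j}ᶜ).Connected :=
      not_not.mp fun h => hj (mem_filter.mpr ⟨mem_univ _, h⟩)
    have : Nat.card (Γ.induce {j}ᶜ).ConnectedComponent = 1 := by
      have := hconn.preconnected.subsingleton_connectedComponent
      have := hconn.nonempty
      exact Nat.card_unique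
    rw [cutNumber, this]
    norm_num
  have h2 : ∀ j : Fin n, cutNumber Γ j = ∑ B : BlockSet Γ, (if j ∈ B.1 then 1 else 0 : ℤ) - 1 := by
    intro j
    rw [cutNumber, card_connectedComponent_compl_singleton hΓ, Nat.card_eq_fintype_card,
      Fintype.card_subtype, Finset.card_filter]
    push_cast
    rfl
  rw [h1]
  simp only [h2]
  rw [Finset.sum_sub_distrib, Finset.sum_comm]
  congr 1
  · refine Finset.sum_congr rfl fun B _ => ?_
    rw [Set.ncard_eq_toFinset_card', ← Finset.sum_filter, Finset.sum_const, nsmul_one]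
    congr 2
    ext v
    simp
  · simp

lemma sum_internalCutEdges (hΓ : Γ.Connected) [DecidablePred (· ∈ internalCutEdges Γ)]
    [DecidablePred (BlockSet.IsLeaf (Γ := Γ))]
    (G : ∀ s : Sym2 (Fin n), (Γ.deleteEdges {s}).ConnectedComponent) :
    ∑ s : Sym2 (Fin n) with s ∈ internalCutEdges Γ, (n.choose (G s).supp.ncard : ℤ) =
      ∑ B : BlockSet Γ with ¬ B.IsLeaf ∧ B.1.ncard = 2,
        (Module.finrank ℂ (gateSpace (gate hΓ B)) : ℤ) := by
  classical
  have hex : ∀ s ∈ ({s | s ∈ internalCutEdges Γ} : Finset (Sym2 (Fin n))),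
      ∃ B : BlockSet Γ, ¬ B.IsLeaf ∧ B.1 = {v | v ∈ s} := fun s hs =>
    (mem_internalCutEdges_iff.mp (mem_filter.mp hs).2).2
  refine Finset.sum_bij (fun s hs => (hex s hs).choose) ?_ ?_ ?_ ?_
  · intro s hs
    obtain ⟨h1, h2⟩ := (hex s hs).choose_spec
    refine mem_filter.mpr ⟨mem_univ _, h1, ?_⟩
    have he := (mem_internalCutEdges_iff.mp (mem_filter.mp hs).2).1
    rw [h2]
    induction s using Sym2.ind with
    | _ i j =>
      have hij : i ≠ j := SimpleGraph.Adj.ne (G := Γ) he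
      rw [← Set.ncard_pair hij]
      congr 1
      ext v
      simp
  · intro s hs s' hs' h
    have h1 := (hex s hs).choose_spec.2
    have h2 := (hex s' hs').choose_spec.2
    rw [h, h2] at h1
    ext v
    exact (Set.ext_iff.mp h1 v).symm
  · intro B hB
    obtain ⟨hl, h2⟩ := (mem_filter.mp hB).2
    obtain ⟨i, j, hij, hBij⟩ := Set.ncard_eq_two.mp h2
    have hadj : Γ.Adj i j := by
      obtain ⟨k, hk, hik⟩ := B.twoConnected.exists_adj (v := i) (by simp [hBij])
      rw [hBij] at hk
      rcases hk with rfl | rfl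
      · exact absurd rfl hik.ne
      · exact hik
    have hs : s(i, j) ∈ ({s | s ∈ internalCutEdges Γ} : Finset (Sym2 (Fin n))) := by
      refine mem_filter.mpr ⟨mem_univ _, mem_internalCutEdges_iff.mpr ⟨hadj, B, hl, ?_⟩⟩
      rw [hBij]
      ext v
      simp
    refine ⟨s(i, j), hs, Subtype.ext ?_⟩
    rw [(hex _ hs).choose_spec.2, hBij]
    ext v
    simp
  · intro s hs
    have he := (mem_internalCutEdges_iff.mp (mem_filter.mp hs).2).1
    rw [finrank_gateSpace_gate_eq_choose hΓ _ he (hex s hs).choose_spec.2 (G s), Fintype.card_fin]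

lemma linDim_eq (hΓ : Γ.Connected)
    (G : ∀ s : Sym2 (Fin n), (Γ.deleteEdges {s}).ConnectedComponent) :
    linDim Γ G = 1 + ∑ B : BlockSet Γ, (Module.finrank ℂ (gateSpace (gate hΓ B)) : ℤ) := by
  classical
  have hleaf : ((leafBlocks Γ).ncard : ℤ) =
      ∑ B : BlockSet Γ, (if B.IsLeaf then 1 else 0 : ℤ) := by
    rw [leafBlocks_eq_image, Set.ncard_image_of_injective _ BlockSet.toSubgraph_injective,
      Set.ncard_eq_toFinset_card', Finset.sum_boole]
    congr 2
    ext B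
    simp
  have hbig : (({B ∈ internalBlocks Γ | 2 < B.verts.ncard}).ncard : ℤ) =
      ∑ B : BlockSet Γ, (if ¬ B.IsLeaf ∧ 2 < B.1.ncard then 1 else 0 : ℤ) := by
    have : {B ∈ internalBlocks Γ | 2 < B.verts.ncard} =
        BlockSet.toSubgraph '' {B : BlockSet Γ | ¬ B.IsLeaf ∧ 2 < B.1.ncard} := by
      rw [internalBlocks_eq_image]
      ext H
      constructor
      · rintro ⟨⟨B, hB, rfl⟩, h⟩
        exact ⟨B, ⟨hB, h⟩, rfl⟩
      · rintro ⟨B, ⟨hB, h⟩, rfl⟩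
        exact ⟨⟨B, hB, rfl⟩, h⟩
    rw [this, Set.ncard_image_of_injective _ BlockSet.toSubgraph_injective,
      Set.ncard_eq_toFinset_card', Finset.sum_boole]
    congr 2
    ext B
    simp
  obtain ⟨r⟩ := hΓ.nonempty
  have hcount : ∑ B : BlockSet Γ, (B.1.ncard : ℤ) + 1 = n + ∑ B : BlockSet Γ, (1 : ℤ) := by
    have := (isGateSystem_gate hΓ).sum_card_add_one r
    simp only [card_gate_fixed, Fintype.card_fin] at this
    have h' : (((∑ B : BlockSet Γ, B.1.ncard) + 1 : ℕ) : ℤ) = _ := congrArg Nat.cast this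
    push_cast at h'
    simpa using h'
  -- The three kinds of block in one formula; an internal edge has `|B| - 2 = 0` and only the last
  -- term. The form `2 * 1` makes the sum over blocks produce the `∑ 1` of `hcount`.
  have hblock : ∀ B : BlockSet Γ, (Module.finrank ℂ (gateSpace (gate hΓ B)) : ℤ) =
      B.1.ncard - 2 * 1 + n * (if B.IsLeaf then 1 else 0) +
        n * (if ¬ B.IsLeaf ∧ 2 < B.1.ncard then 1 else 0) +
        if ¬ B.IsLeaf ∧ B.1.ncard = 2 then
          (Module.finrank ℂ (gateSpace (gate hΓ B)) : ℤ) else 0 := by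
    intro B
    rcases B.two_le_ncard.eq_or_lt with h2 | h2
    · by_cases hl : B.IsLeaf
      · rw [finrank_gateSpace_gate_of_isLeaf hΓ B h2.symm hl]
        simp [hl, ← h2]
      · simp [hl, ← h2]
    · have := finrank_gateSpace_gate_of_two_lt hΓ B h2
      rw [Fintype.card_fin] at this
      have h' : (Module.finrank ℂ (gateSpace (gate hΓ B)) : ℤ) + 2 = n + B.1.ncard := by
        exact_mod_cast this
      by_cases hl : B.IsLeaf
      · simp [hl]
        linarith
      · simp [hl, h2, h2.ne']
        linarith
  rw [linDim, sum_cutNumber hΓ, hleaf, hbig, sum_internalCutEdges hΓ G, Finset.sum_filter]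
  rw [Finset.sum_congr rfl fun B _ => hblock B]
  simp only [Finset.sum_add_distrib, Finset.sum_sub_distrib, ← Finset.mul_sum]
  linear_combination -2 * hcount

lemma finrank_splinesDeg_one (hΓ : Γ.Connected)
    (G : ∀ s : Sym2 (Fin n), (Γ.deleteEdges {s}).ConnectedComponent) :
    (Module.finrank ℂ (splinesDeg Γ 1) : ℤ) = linDim Γ G := by
  rw [linDim_eq hΓ, (splinesDegOneEquiv Γ).finrank_eq, finrank_edgeForms hΓ,
    (isGateSystem_gate hΓ).finrank_zeroSumForms]
  push_cast
  ring

end Dimension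

end CayleySplines

theorem mainTheorem4 {n : ℕ} (hn : 3 ≤ n) (Γ : SimpleGraph (Fin n)) (hΓ : Γ.Connected)
    (G : ∀ s : Sym2 (Fin n), (Γ.deleteEdges {s}).ConnectedComponent) :
    (Module.Finite ℂ (CayleySplines.splinesDeg Γ 1) ∧
      (Module.finrank ℂ (CayleySplines.splinesDeg Γ 1) : ℤ) = CayleySplines.linDim Γ G) ∧
    (Module.Finite ℂ (CayleySplines.leftDeg Γ 1) ∧
      (Module.finrank ℂ (CayleySplines.leftDeg Γ 1) : ℤ) = CayleySplines.linDim Γ G - n) ∧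
    (Module.Finite ℂ (CayleySplines.rightDeg Γ 1) ∧
      (Module.finrank ℂ (CayleySplines.rightDeg Γ 1) : ℤ) = CayleySplines.linDim Γ G - n) := by
  have hS := CayleySplines.finrank_splinesDeg_one hΓ G
  -- The generators permute the variables at `w` by the identity for `t̄` and by `w` itself for
  -- `x̄`.
  obtain ⟨hL, hL'⟩ := CayleySplines.finrank_map_mk_splinesDeg_one hΓ (CayleySplines.tSpline Γ)
    (fun _ => 1) (fun _ _ => rfl)
  obtain ⟨hR, hR'⟩ := CayleySplines.finrank_map_mk_splinesDeg_one hΓ (CayleySplines.xSpline Γ)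
    id (fun _ _ => rfl)
  refine ⟨⟨inferInstance, hS⟩, ⟨hL, ?_⟩, ⟨hR, ?_⟩⟩
  · rw [← hS, ← hL', Nat.cast_add, add_sub_cancel_right]
    rfl
  · rw [← hS, ← hR', Nat.cast_add, add_sub_cancel_right]
    rfl
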